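/- **Setting.** Let $\Theta$ be a compact domain without boundary with $d$-dimensional Euclidean geometry, that is, a closed flat manifold $\Theta=\mathbb{R}^d/\Gamma$, where $\Gamma$ is a group acting on $\mathbb{R}^d$ freely, properly discontinuously and by Euclidean isometries with compact quotient (for instance a flat torus). Functions on $\Theta$ are identified with $\Gamma$-invariant functions on $\mathbb{R}^d$; smoothness, $\nabla$ and $\nabla\cdot$ are the Euclidean ones, and $d\theta$ is Lebesgue measure on a fundamental domain of $\Gamma$. Let $\mathcal{D}$ be a set of datasets with a symmetric neighbouring relation $\sim$. A randomized mechanism $M$ assigns to each $D\in\mathcal{D}$ a random output in $\Theta$ (a probability law on $\Theta$); it is $(\varepsilon,\delta)$-DP if $\mathbb{P}(M(D)\in S)\le e^{\varepsilon}\,\mathbb{P}(M(D')\in S)+\delta$ for all $D\sim D'$ and all measurable $S\subseteq\Theta$. For each $D\in\mathcal{D}$ let $V_D:\Theta\to\mathbb{R}$ be a $C^2$ potential and $\pi_D=e^{-V_D}/\int_\Theta e^{-V_D}\,d\theta$. Fix $T>0$ and an initial probability density $\rho_0$ on $\Theta$, the same for all datasets, and suppose that for each $D$ the family $(\rho_t^D)_{0\le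 t\le T}$ is a strictly positive classical solution, of class $C^{1,2}([0,T]\times\Theta)$ (the function, its time derivative and its space derivatives up to order two exist and are continuous on $[0,T]\times\Theta$), of $$\partial_t\rho_t^D=\nabla\cdot\left(\nabla\rho_t^D+\rho_t^D\nabla V_D\right)-\alpha_t^D\rho_t^D,\qquad \alpha_t^D=\log\frac{\rho_t^D}{\pi_D}-\int_\Theta\log\frac{\rho_t^D}{\pi_D}\,\rho_t^D\,d\theta,\qquad \rho_0^D=\rho_0 .$$ **Assumptions.** There are constants $\Delta_{\mathrm{gradpot}}$, $\lambda_{\mathrm{Gibbs}}>0$ and $B\ge 0$, independent of the datasets, such that: 1. $\sup_{\theta\in\Theta}\|\nabla V_D(\theta)-\nabla V_{D'}(\theta)\|\le\Delta_{\mathrm{gradpot}}$ for all $D\sim D'$; 2. every $\pi_D$ satisfies the log-Sobolev inequality with constant $\lambda_{\mathrm{Gibbs}}$: for all smooth $f$ with $\int f^2\,d\pi_D=1$, $\int f^2\log f^2\,d\pi_D\le\frac{2}{\lambda_{\mathrm{Gibbs}}}\int\|\nabla f\|^2\,d\pi_D$; 3. $R_D:=\max_\Theta\log\frac{\rho_0}{\pi_D}-\min_\Theta\log\frac{\rho_0}{\pi_D}\le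 B$ for every $D$. **Conclusion.** Let $S_{\mathrm{tar}}$ be a constant such that $\left|\log\frac{\pi_D(\theta)}{\pi_{D'}(\theta)}\right|\le S_{\mathrm{tar}}$ for all $D\sim D'$ and $\theta\in\Theta$. Then for all $t\in[0,T]$, all $0<c<1$ and all $\varepsilon>0$, the mechanism $M_t$ that on input $D$ outputs $\theta_t\sim\rho_t^D$ is $(\varepsilon,\delta_t)$-DP with $\delta_t=\bar H(t)/\varepsilon$. Here, with $$A_1=\frac{\Delta_{\mathrm{gradpot}}^2}{4c},\quad A_2=B\left(\frac{S_{\mathrm{tar}}}{2}+2\right),\quad A_3=\frac{B^2}{16},\quad \kappa=2(1-c)e^{-B}\lambda_{\mathrm{Gibbs}},$$ $$\bar H(t)=\begin{cases}A_1\frac{1-e^{-\kappa t}}{\kappa}+A_2\frac{e^{-t}-e^{-\kappa t}}{\kappa-1}+A_3\frac{e^{-2t}-e^{-\kappa t}}{\kappa-2},&\kappa\ne1,2,\\[1ex] A_1\frac{1-e^{-\kappa t}}{\kappa}+A_2\,t e^{-t}+A_3\frac{e^{-2t}-e^{-\kappa t}}{\kappa-2},&\kappa=1,\\[1ex] A_1\frac{1-e^{-\kappa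 t}}{\kappa}+A_2\frac{e^{-t}-e^{-\kappa t}}{\kappa-1}+A_3\,t e^{-2t},&\kappa=2.\end{cases}$$ Moreover, if $\sup_{\theta\in\Theta}|V_D(\theta)-V_{D'}(\theta)|\le\Delta_{\mathrm{pot}}$ for all $D\sim D'$, then $S_{\mathrm{tar}}=2\Delta_{\mathrm{pot}}$ is a valid choice, and if $\sup_\Theta(V_D-V_{D'})-\inf_\Theta(V_D-V_{D'})\le\Delta_{\mathrm{pot,osc}}$ for all $D\sim D'$, then $S_{\mathrm{tar}}=\Delta_{\mathrm{pot,osc}}$ is a valid choice. -/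

import Mathlib

open MeasureTheory Set
open scoped Gradient ContDiff

noncomputable section

/-- `ℝ^d` with the Euclidean norm. -/
abbrev Eucl (d : ℕ) : Type := EuclideanSpace ℝ (Fin d)

/-- The quotient `Θ = ℝ^d / Γ`. It carries the quotient topology and the quotient
σ-algebra. When `Γ` acts freely, properly discontinuously and by isometries with compact quotient,
this is a closed flat manifold (the torus `ℝ^d / ℤ^d` if `Γ = ℤ^d` acts by translations). -/
abbrev FlatQuotient (d : ℕ) (Γ : Type*) [Group Γ] [MulAction Γ (Eucl d)] : Type :=
  MulAction.orbitRel.Quotient Γ (Eucl d)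

variable {d : ℕ} {Γ : Type*} [Group Γ] [MulAction Γ (Eucl d)]

/-- The covering map `ℝ^d → Θ`. -/
def cover (d : ℕ) (Γ : Type*) [Group Γ] [MulAction Γ (Eucl d)] (x : Eucl d) : FlatQuotient d Γ :=
  Quotient.mk (MulAction.orbitRel Γ (Eucl d)) x

/-- The `Γ`-periodic function on `ℝ^d` that corresponds to a function on `Θ`. Smoothness and
derivatives of functions on `Θ` are those of their lifts. -/
def lift (f : FlatQuotient d Γ → ℝ) : Eucl d → ℝ := fun x => f (cover d Γ x)

theorem norm_gradient_lift_smul [IsIsometricSMul Γ (Eucl d)] (f : FlatQuotient d Γ → ℝ)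
    (γ : Γ) (x : Eucl d) : ‖∇ (lift f) (γ • x)‖ = ‖∇ (lift f) x‖ := by
  have hA : (fun y : Eucl d => lift f (γ • y)) = lift f := by
    funext y
    exact congrArg f (Quotient.sound ⟨γ, rfl⟩)
  set A := (IsometryEquiv.constSMul γ : Eucl d ≃ᵢ Eucl d).toRealAffineIsometryEquiv with hAdef
  have hd : HasFDerivAt (fun y : Eucl d => γ • y)
      (A.linearIsometryEquiv.toContinuousLinearEquiv : Eucl d →L[ℝ] Eucl d) x := by
    have h1 : (fun y : Eucl d => γ • y) =
        fun y => A.linearIsometryEquiv y + A 0 := by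
      funext y
      have := A.map_vadd 0 y
      simpa [hAdef] using this
    rw [h1]
    exact (A.linearIsometryEquiv.toContinuousLinearEquiv.hasFDerivAt (x := x)).add_const _
  have hinv : HasFDerivAt (fun y : Eucl d => γ⁻¹ • y)
      (A.linearIsometryEquiv.toContinuousLinearEquiv.symm : Eucl d →L[ℝ] Eucl d) (γ • x) := by
    have h1 : (fun y : Eucl d => γ⁻¹ • y) =
        fun y => A.linearIsometryEquiv.symm y + γ⁻¹ • (0 : Eucl d) := by
      funext y
      have h2 := A.map_vadd (γ⁻¹ • (0 : Eucl d)) (A.linearIsometryEquiv.symm y)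
      have h3 : γ • (A.linearIsometryEquiv.symm y + γ⁻¹ • (0 : Eucl d)) = y := by
        simpa [hAdef] using h2
      rw [← h3, inv_smul_smul, h3]
    rw [h1]
    exact (A.linearIsometryEquiv.symm.toContinuousLinearEquiv.hasFDerivAt (x := γ • x)).add_const _
  have key : fderiv ℝ (lift f) x =
      (fderiv ℝ (lift f) (γ • x)).comp
        (A.linearIsometryEquiv.toContinuousLinearEquiv : Eucl d →L[ℝ] Eucl d) := by
    by_cases h : DifferentiableAt ℝ (lift f) (γ • x)
    · have := (h.hasFDerivAt.comp x hd).fderiv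
      rw [← this]
      exact congrArg (fun g => fderiv ℝ g x) hA.symm
    · have h' : ¬ DifferentiableAt ℝ (lift f) x := by
        intro hx
        apply h
        have hx' : DifferentiableAt ℝ (lift f) (γ⁻¹ • γ • x) := by rwa [inv_smul_smul]
        have := hx'.comp (γ • x) hinv.differentiableAt
        have e : (lift f) ∘ (fun y : Eucl d => γ⁻¹ • y) = lift f := by
          funext y
          exact congrArg f (Quotient.sound ⟨γ⁻¹, rfl⟩)
        rwa [e] at this
      rw [fderiv_zero_of_not_differentiableAt h, fderiv_zero_of_not_differentiableAt h']
      simp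
  unfold gradient
  rw [LinearIsometryEquiv.norm_map, LinearIsometryEquiv.norm_map, key]
  exact (ContinuousLinearMap.opNorm_comp_linearIsometryEquiv _ A.linearIsometryEquiv).symm

/-- `‖∇ f‖` as a function on `Θ`. -/
def gradNorm [IsIsometricSMul Γ (Eucl d)] (f : FlatQuotient d Γ → ℝ) (θ : FlatQuotient d Γ) : ℝ :=
  Quotient.lift (fun x => ‖∇ (lift f) x‖)
    (by rintro _ x ⟨γ, rfl⟩; exact norm_gradient_lift_smul f γ x) θ

/-- The divergence of a vector field on `ℝ^d`. -/
def divergence (X : Eucl d → Eucl d) (x : Eucl d) : ℝ :=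
  ∑ i : Fin d, (fderiv ℝ X x (EuclideanSpace.single i 1)) i

/-- The Lebesgue (Riemannian) measure on `Θ`: the image of Lebesgue measure on a fundamental
domain `F` of `Γ`. It does not depend on `F`. -/
def vol (F : Set (Eucl d)) : Measure (FlatQuotient d Γ) :=
  (volume.restrict F).map (cover d Γ)

/-- The measure on `Θ` with density `ρ`. -/
def densityMeasure (F : Set (Eucl d)) (ρ : FlatQuotient d Γ → ℝ) : Measure (FlatQuotient d Γ) :=
  (vol F).withDensity fun θ => ENNReal.ofReal (ρ θ)

/-- The Gibbs density `π = exp(-V) / ∫ exp(-V)`. -/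
def gibbs (F : Set (Eucl d)) (V : FlatQuotient d Γ → ℝ) (θ : FlatQuotient d Γ) : ℝ :=
  Real.exp (-V θ) / ∫ η, Real.exp (-V η) ∂(vol F)

/-- The oscillation `sup f - inf f`. -/
def osc (f : FlatQuotient d Γ → ℝ) : ℝ := (⨆ θ, f θ) - ⨅ θ, f θ

/-- The time derivative, relative to the interval `[0, T]` (one-sided at the end points). -/
def timeDeriv (T : ℝ) (u : ℝ → FlatQuotient d Γ → ℝ) (t : ℝ) (θ : FlatQuotient d Γ) : ℝ :=
  derivWithin (fun s => u s θ) (Icc 0 T) t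

/-- The class `C^{1,2}([0, T] × Θ)`: `u`, its time derivative and its space derivatives up to
order two exist and are continuous on `[0, T] × Θ`. -/
structure IsC12 (T : ℝ) (u : ℝ → FlatQuotient d Γ → ℝ) : Prop where
  differentiable_time : ∀ t ∈ Icc 0 T, ∀ θ,
    DifferentiableWithinAt ℝ (fun s => u s θ) (Icc 0 T) t
  contDiff_space : ∀ t ∈ Icc 0 T, ContDiff ℝ 2 (lift (u t))
  continuous : ContinuousOn (fun p : ℝ × Eucl d => lift (u p.1) p.2) (Icc 0 T ×ˢ univ)
  continuous_time : ContinuousOn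
    (fun p : ℝ × Eucl d => lift (timeDeriv T u p.1) p.2) (Icc 0 T ×ˢ univ)
  continuous_space : ContinuousOn
    (fun p : ℝ × Eucl d => fderiv ℝ (lift (u p.1)) p.2) (Icc 0 T ×ˢ univ)
  continuous_space_two : ContinuousOn
    (fun p : ℝ × Eucl d => fderiv ℝ (fderiv ℝ (lift (u p.1))) p.2) (Icc 0 T ×ˢ univ)

/-- The centered birth-death rate
`α = log ρ - log π - ∫ (log ρ - log π) dρ`, with `π` the Gibbs density of `V`. -/
def birthDeathRate (F : Set (Eucl d)) (V ρ : FlatQuotient d Γ → ℝ) (θ : FlatQuotient d Γ) : ℝ :=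
  Real.log (ρ θ) - Real.log (gibbs F V θ)
    - ∫ η, (Real.log (ρ η) - Real.log (gibbs F V η)) ∂(densityMeasure F ρ)

/-- `ρ` is a strictly positive classical solution on `[0, T]` of
`∂ₜ ρ = ∇ · (∇ ρ + ρ ∇ V) - α ρ`. -/
structure IsSHKSolution (F : Set (Eucl d)) (T : ℝ) (V : FlatQuotient d Γ → ℝ)
    (ρ : ℝ → FlatQuotient d Γ → ℝ) : Prop where
  isC12 : IsC12 T ρ
  pos : ∀ t ∈ Icc 0 T, ∀ θ, 0 < ρ t θ
  equation : ∀ t ∈ Icc 0 T, ∀ x : Eucl d,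
    timeDeriv T ρ t (cover d Γ x) =
      divergence (fun y => ∇ (lift (ρ t)) y + lift (ρ t) y • ∇ (lift V) y) x
        - birthDeathRate F V (ρ t) (cover d Γ x) * ρ t (cover d Γ x)

/-- The log-Sobolev inequality with constant `l` for a probability measure `μ` on `Θ`. -/
def SatisfiesLSI [IsIsometricSMul Γ (Eucl d)] (μ : Measure (FlatQuotient d Γ)) (l : ℝ) : Prop :=
  ∀ f : FlatQuotient d Γ → ℝ, ContDiff ℝ ∞ (lift f) → ∫ θ, f θ ^ 2 ∂μ = 1 →
    ∫ θ, f θ ^ 2 * Real.log (f θ ^ 2) ∂μ ≤ 2 / l * ∫ θ, gradNorm f θ ^ 2 ∂μ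

/-- `(ε, δ)`-differential privacy of a randomized mechanism, given by the law `M D` of its output
for every dataset `D`, with respect to the neighbouring relation `adj`. -/
structure IsApproxDP {𝒟 Ω : Type*} [MeasurableSpace Ω] (adj : 𝒟 → 𝒟 → Prop)
    (M : 𝒟 → Measure Ω) (ε δ : ℝ) : Prop where
  isProbabilityMeasure : ∀ D, IsProbabilityMeasure (M D)
  le : ∀ D D', adj D D' → ∀ S, MeasurableSet S →
    (M D).real S ≤ Real.exp ε * (M D').real S + δ

/-- The explicit bound `H̄(t)`, as a function of `A₁, A₂, A₃, κ` and `t`. -/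
def klBoundAux (A₁ A₂ A₃ κ t : ℝ) : ℝ :=
  if κ = 1 then
    A₁ * ((1 - Real.exp (-κ * t)) / κ) + A₂ * (t * Real.exp (-t))
      + A₃ * ((Real.exp (-2 * t) - Real.exp (-κ * t)) / (κ - 2))
  else if κ = 2 then
    A₁ * ((1 - Real.exp (-κ * t)) / κ)
      + A₂ * ((Real.exp (-t) - Real.exp (-κ * t)) / (κ - 1))
      + A₃ * (t * Real.exp (-2 * t))
  else
    A₁ * ((1 - Real.exp (-κ * t)) / κ)
      + A₂ * ((Real.exp (-t) - Real.exp (-κ * t)) / (κ - 1))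
      + A₃ * ((Real.exp (-2 * t) - Real.exp (-κ * t)) / (κ - 2))

/-- The explicit bound `H̄(t)` in terms of the gradient sensitivity `Δ`, the bound `B` on the
initial oscillations, the bound `S` on the log-ratio of the targets, the log-Sobolev constant `l`
and the parameter `c`. -/
def klBound (Δ B S l c t : ℝ) : ℝ :=
  klBoundAux (Δ ^ 2 / (4 * c)) (B * (S / 2 + 2)) (B ^ 2 / 16)
    (2 * (1 - c) * Real.exp (-B) * l) t

end

/-!
The privacy loss between two neighbouring datasets is controlled by the Kullback–Leibler divergence
`H(t) = ∫ ρ log (ρ / ρ')` of the two flows `ρ`, `ρ'` with potentials `V`, `V'`: pointwise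
`ρ - e^ε ρ' ≤ (ρ log (ρ / ρ') - ρ + ρ') / ε`, so that `δ = H / ε` suffices
(`densityMeasure_real_le_of_klDiv_le`). It remains to bound `H`, which vanishes at time `0`. Its
derivative has two parts.

* Transport. By integration by parts on `Θ` (`setIntegral_mul_divergence`), the Fokker–Planck terms
  contribute `-I + ∫ ρ ⟨∇ (V' - V), ∇ log (ρ / ρ')⟩ ≤ -(1 - c) I + Δ² / (4 c)`, with
  `I = ∫ ρ ‖∇ log (ρ / ρ')‖²` the relative Fisher information (`integral_transport_le`).
  The log-Sobolev inequality of `π'` passes to `ρ'` by the Holley–Stroock argument, at the price of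
  a factor `exp (-B)`, because `log (ρ' / π')` oscillates by at most `B`; hence
  `(1 - c) I ≥ κ H` (`SatisfiesLSI.klDiv_le_fisher`).
* Birth and death. With `u = log (ρ / π)` and `u' = log (ρ' / π')`, these terms are the covariance
  under `ρ` of `u` with `-log (ρ / ρ')` and a difference of means of `u'`. They are controlled by
  the oscillations of `u` and `u'` and by `S` (`integral_birthDeath_le`).

The oscillation of `log (ρ_t / π)` is at most `B exp (-t)` by a maximum principle for
`exp t * (u t θ - u t η)` on the compact space `[0, T] × Θ × Θ`
(`IsSHKSolution.log_add_sub_le`): the nonlocal mean in the birth-death rate cancels in the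
difference. Therefore `H' ≤ A₁ + A₂ exp (-t) + A₃ exp (-2 t) - κ H`, and the explicit bound
is the solution of the corresponding linear equation that vanishes at `0`
(`IsSHKSolution.klDiv_le_klBound`).

Two tools are developed on the way. The divergence theorem on `Θ` for an arbitrary
fundamental domain follows from the one on `ℝ^d` for compactly supported fields, with a
smooth function whose translates by `Γ` sum to `1` (`setIntegral_divergence_eq_zero`). The
log-Sobolev inequality, which is assumed for smooth functions only, is extended to `C¹` functions by
convolution with a radial mollifier, which commutes with the isometries of `Γ`
(`SatisfiesLSI.integral_sq_mul_log_sq_le_of_contDiff_one`).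
-/

noncomputable section

variable {d : ℕ} {Γ : Type*} [Group Γ] [MulAction Γ (Eucl d)]

/-! ### The quotient, the group action and the Lebesgue measure on `Θ` -/

theorem lift_smul (f : FlatQuotient d Γ → ℝ) (γ : Γ) (x : Eucl d) :
    lift f (γ • x) = lift f x :=
  congrArg f (Quotient.sound ⟨γ, rfl⟩)

theorem cover_surjective : Function.Surjective (cover d Γ) :=
  Quotient.mk_surjective

theorem measurable_cover : Measurable (cover d Γ) :=
  fun _ h => h

theorem continuous_of_continuous_lift {f : FlatQuotient d Γ → ℝ} (hf : Continuous (lift f)) :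
    Continuous f :=
  isQuotientMap_quot_mk.continuous_iff.2 hf

theorem measurable_of_continuous_lift {f : FlatQuotient d Γ → ℝ} (hf : Continuous (lift f)) :
    Measurable f :=
  measurable_from_quotient.2 hf.measurable

/-- The function on `Θ` induced by a function on `ℝ^d`; it is meant for `Γ`-invariant functions,
and on others it picks the value at an arbitrary representative of the orbit. -/
def descend (g : Eucl d → ℝ) (θ : FlatQuotient d Γ) : ℝ := g (Quotient.out θ)

theorem lift_descend {g : Eucl d → ℝ} (hg : ∀ (γ : Γ) x, g (γ • x) = g x) :
    lift (descend g : FlatQuotient d Γ → ℝ) = g := by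
  funext x
  obtain ⟨γ, hγ⟩ : ∃ γ : Γ, γ • x = Quotient.out (cover d Γ x) :=
    Quotient.exact (Quotient.out_eq (cover d Γ x))
  change g (Quotient.out (cover d Γ x)) = g x
  rw [← hγ, hg]

/-- The group `Γ` is countable: the elements that move a ball of radius `n` so that it meets
itself are finitely many, and every element does so for some `n`. -/
theorem countable_group [ProperlyDiscontinuousSMul Γ (Eucl d)] : Countable Γ := by
  have h : (univ : Set Γ) ⊆ ⋃ n : ℕ, {γ : Γ | (((γ • ·) '' Metric.closedBall (0 : Eucl d) n) ∩
      Metric.closedBall (0 : Eucl d) n).Nonempty} := by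
    intro γ _
    obtain ⟨n, hn⟩ := exists_nat_ge ‖γ • (0 : Eucl d)‖
    exact mem_iUnion.2 ⟨n, γ • (0 : Eucl d), ⟨0, by simp, rfl⟩, by simpa using hn⟩
  rw [← Set.countable_univ_iff]
  refine Set.Countable.mono h (Set.countable_iUnion fun n => ?_)
  exact (ProperlyDiscontinuousSMul.finite_disjoint_inter_image
    (isCompact_closedBall _ _) (isCompact_closedBall _ _)).countable

theorem integral_vol {F : Set (Eucl d)} {f : FlatQuotient d Γ → ℝ} (hf : Measurable f) :
    ∫ θ, f θ ∂(vol F) = ∫ x in F, lift f x :=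
  integral_map measurable_cover.aemeasurable hf.aestronglyMeasurable

theorem exists_bound_of_continuous_lift [CompactSpace (FlatQuotient d Γ)]
    {f : FlatQuotient d Γ → ℝ} (hf : Continuous (lift f)) : ∃ C, ∀ θ, |f θ| ≤ C := by
  obtain ⟨C, hC⟩ := isCompact_univ.exists_bound_of_continuousOn
    (continuous_of_continuous_lift hf).continuousOn
  exact ⟨C, fun θ => hC θ (mem_univ θ)⟩

theorem bddAbove_of_continuous_lift [CompactSpace (FlatQuotient d Γ)]
    {f : FlatQuotient d Γ → ℝ} (hf : Continuous (lift f)) : BddAbove (range f) := by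
  obtain ⟨C, hC⟩ := exists_bound_of_continuous_lift hf
  exact ⟨C, by rintro _ ⟨θ, rfl⟩; exact (abs_le.1 (hC θ)).2⟩

theorem bddBelow_of_continuous_lift [CompactSpace (FlatQuotient d Γ)]
    {f : FlatQuotient d Γ → ℝ} (hf : Continuous (lift f)) : BddBelow (range f) := by
  obtain ⟨C, hC⟩ := exists_bound_of_continuous_lift hf
  exact ⟨-C, by rintro _ ⟨θ, rfl⟩; exact (abs_le.1 (hC θ)).1⟩

theorem sub_le_osc [CompactSpace (FlatQuotient d Γ)]
    {f : FlatQuotient d Γ → ℝ} (hf : Continuous (lift f)) (θ η : FlatQuotient d Γ) :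
    f θ - f η ≤ osc f :=
  sub_le_sub (le_ciSup (bddAbove_of_continuous_lift hf) θ)
    (ciInf_le (bddBelow_of_continuous_lift hf) η)

theorem integrable_of_continuous_lift [CompactSpace (FlatQuotient d Γ)]
    {μ : Measure (FlatQuotient d Γ)} [IsFiniteMeasure μ]
    {f : FlatQuotient d Γ → ℝ} (hf : Continuous (lift f)) : Integrable f μ := by
  obtain ⟨C, hC⟩ := exists_bound_of_continuous_lift hf
  exact Integrable.of_bound (measurable_of_continuous_lift hf).aestronglyMeasurable C
    (Filter.Eventually.of_forall hC)

section Isometries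

variable [IsIsometricSMul Γ (Eucl d)]

/-- The linear part of the Euclidean isometry `x ↦ γ • x`. -/
def linPart (d : ℕ) {Γ : Type*} [Group Γ] [MulAction Γ (Eucl d)] [IsIsometricSMul Γ (Eucl d)]
    (γ : Γ) : Eucl d ≃ₗᵢ[ℝ] Eucl d :=
  ((IsometryEquiv.constSMul γ : Eucl d ≃ᵢ Eucl d).toRealAffineIsometryEquiv).linearIsometryEquiv

theorem smul_eq_linPart (γ : Γ) (x : Eucl d) :
    γ • x = linPart d γ x + γ • (0 : Eucl d) := by
  have := ((IsometryEquiv.constSMul γ : Eucl d ≃ᵢ Eucl d).toRealAffineIsometryEquiv).map_vadd 0 x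
  simpa [linPart] using this

theorem smul_add_eq (γ : Γ) (x v : Eucl d) : γ • (x + v) = γ • x + linPart d γ v := by
  rw [smul_eq_linPart, smul_eq_linPart γ x, map_add]; abel

theorem contDiff_smul_group (γ : Γ) : ContDiff ℝ ∞ (fun x : Eucl d => γ • x) := by
  have h : (fun x : Eucl d => γ • x) = fun x => linPart d γ x + γ • (0 : Eucl d) :=
    funext (smul_eq_linPart γ)
  rw [h]
  exact (linPart d γ).contDiff.add contDiff_const

theorem hasFDerivAt_smul_group (γ : Γ) (x : Eucl d) :
    HasFDerivAt (fun x : Eucl d => γ • x)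
      ((linPart d γ).toContinuousLinearEquiv : Eucl d →L[ℝ] Eucl d) x := by
  have h : (fun x : Eucl d => γ • x) = fun x => linPart d γ x + γ • (0 : Eucl d) :=
    funext (smul_eq_linPart γ)
  rw [h]
  exact ((linPart d γ).toContinuousLinearEquiv.hasFDerivAt (x := x)).add_const _

instance smulInvariantMeasure_volume : SMulInvariantMeasure Γ (Eucl d) volume := by
  refine ⟨fun γ s hs => ?_⟩
  have h : (fun x : Eucl d => γ • x) = (fun y => y + γ • (0 : Eucl d)) ∘ linPart d γ :=
    funext (smul_eq_linPart γ)
  have hm : MeasurePreserving (fun x : Eucl d => γ • x) volume volume := by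
    rw [h]
    exact (measurePreserving_add_right volume _).comp (linPart d γ).measurePreserving
  exact hm.measure_preimage hs.nullMeasurableSet

theorem fderiv_smul_apply {f : Eucl d → ℝ} (hinv : ∀ (γ : Γ) x, f (γ • x) = f x)
    (hf : Differentiable ℝ f) (γ : Γ) (x v : Eucl d) :
    fderiv ℝ f (γ • x) (linPart d γ v) = fderiv ℝ f x v := by
  have h := ((hf (γ • x)).hasFDerivAt.comp x (hasFDerivAt_smul_group γ x)).fderiv
  have e : (f ∘ fun x : Eucl d => γ • x) = f := funext (hinv γ)
  rw [e] at h
  rw [h]; rfl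

theorem gradient_smul {f : Eucl d → ℝ} (hinv : ∀ (γ : Γ) x, f (γ • x) = f x)
    (hf : Differentiable ℝ f) (γ : Γ) (x : Eucl d) :
    ∇ f (γ • x) = linPart d γ (∇ f x) := by
  refine ext_inner_right ℝ fun w => ?_
  obtain ⟨v, rfl⟩ := (linPart d γ).surjective w
  rw [LinearIsometryEquiv.inner_map_map]
  simp only [gradient, InnerProductSpace.toDual_symm_apply]
  exact fderiv_smul_apply hinv hf γ x v

theorem exists_isCompact_surjOn [CompactSpace (FlatQuotient d Γ)] :
    ∃ K : Set (Eucl d), IsCompact K ∧ ∀ x : Eucl d, ∃ γ : Γ, γ • x ∈ K := by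
  have hopen : IsOpenMap (cover d Γ) := isOpenMap_quotient_mk'_mul
  obtain ⟨n, hn⟩ : ∃ n : ℕ, (univ : Set (FlatQuotient d Γ)) ⊆
      cover d Γ '' Metric.ball (0 : Eucl d) n := by
    have := isCompact_univ.elim_directed_cover
      (fun n : ℕ => cover d Γ '' Metric.ball (0 : Eucl d) n)
      (fun n => hopen _ Metric.isOpen_ball) (by
        intro θ _
        obtain ⟨x, rfl⟩ := cover_surjective θ
        obtain ⟨n, hn⟩ := exists_nat_gt ‖x‖
        exact mem_iUnion.2 ⟨n, x, by simpa using hn, rfl⟩)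
      (directed_of_isDirected_le fun m n hmn =>
        image_mono (Metric.ball_subset_ball (by exact_mod_cast hmn)))
    exact this
  refine ⟨Metric.closedBall 0 n, isCompact_closedBall _ _, fun x => ?_⟩
  obtain ⟨y, hy, hyx⟩ := hn (mem_univ (cover d Γ x))
  obtain ⟨γ, hγ⟩ : ∃ γ : Γ, γ • x = y := Quotient.exact hyx
  exact ⟨γ, hγ ▸ Metric.ball_subset_closedBall hy⟩

open scoped Pointwise in
theorem isFiniteMeasure_vol [ProperlyDiscontinuousSMul Γ (Eucl d)]
    [CompactSpace (FlatQuotient d Γ)] {F : Set (Eucl d)}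
    (hF : IsFundamentalDomain Γ F volume) :
    IsFiniteMeasure (vol F : Measure (FlatQuotient d Γ)) := by
  have := countable_group (d := d) (Γ := Γ)
  obtain ⟨K, hK, hsurj⟩ := exists_isCompact_surjOn (d := d) (Γ := Γ)
  have hfin : volume F < ⊤ := by
    refine lt_of_le_of_lt ?_ (hK.measure_lt_top (μ := volume))
    rw [hF.measure_eq_tsum K]
    refine (measure_mono fun x hx => ?_).trans (measure_iUnion_le fun γ : Γ => γ • K ∩ F)
    obtain ⟨γ, hγ⟩ := hsurj x
    exact mem_iUnion.2 ⟨γ⁻¹, ⟨γ • x, hγ, inv_smul_smul γ x⟩, hx⟩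
  have : IsFiniteMeasure (volume.restrict F) := ⟨by simpa using hfin⟩
  unfold vol; infer_instance

theorem vol_ne_zero [ProperlyDiscontinuousSMul Γ (Eucl d)] {F : Set (Eucl d)}
    (hF : IsFundamentalDomain Γ F volume) :
    (vol F : Measure (FlatQuotient d Γ)) ≠ 0 := by
  have := countable_group (d := d) (Γ := Γ)
  have h := hF.measure_ne_zero (NeZero.ne _)
  unfold vol
  rw [Ne, Measure.map_eq_zero_iff measurable_cover.aemeasurable, Measure.restrict_eq_zero]
  exact h

/-- A continuous family of functions on `Θ` is uniformly bounded over `[0, T]`. -/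
theorem exists_bound_of_continuousOn_prod [CompactSpace (FlatQuotient d Γ)] {T : ℝ}
    {w : ℝ → FlatQuotient d Γ → ℝ}
    (hw : ContinuousOn (fun p : ℝ × Eucl d => lift (w p.1) p.2) (Icc 0 T ×ˢ univ)) :
    ∃ C, ∀ t ∈ Icc 0 T, ∀ θ, |w t θ| ≤ C := by
  obtain ⟨K, hK, hsurj⟩ := exists_isCompact_surjOn (d := d) (Γ := Γ)
  obtain ⟨C, hC⟩ := (isCompact_Icc.prod hK).exists_bound_of_continuousOn
    (hw.mono (prod_mono_right (subset_univ K)))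
  refine ⟨C, fun t ht θ => ?_⟩
  obtain ⟨x, rfl⟩ := cover_surjective θ
  obtain ⟨γ, hγ⟩ := hsurj x
  have := hC (t, γ • x) ⟨ht, hγ⟩
  rwa [lift_smul] at this

end Isometries

/-! ### The divergence theorem on `Θ` -/

theorem divergence_eq_trace (X : Eucl d → Eucl d) (x : Eucl d) :
    divergence X x = LinearMap.trace ℝ (Eucl d) (fderiv ℝ X x : Eucl d →ₗ[ℝ] Eucl d) := by
  rw [LinearMap.trace_eq_sum_inner _ (EuclideanSpace.basisFun (Fin d) ℝ)]
  refine Finset.sum_congr rfl fun i _ => ?_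
  simp [EuclideanSpace.inner_single_left]

theorem divergence_smul_group [IsIsometricSMul Γ (Eucl d)] {X : Eucl d → Eucl d}
    (hX : Differentiable ℝ X) (hequiv : ∀ (γ : Γ) x, X (γ • x) = linPart d γ (X x))
    (γ : Γ) (x : Eucl d) : divergence X (γ • x) = divergence X x := by
  set A : Eucl d ≃L[ℝ] Eucl d := (linPart d γ).toContinuousLinearEquiv with hA
  have h1 : HasFDerivAt (fun y => X (γ • y)) ((fderiv ℝ X (γ • x)).comp (A : Eucl d →L[ℝ] Eucl d))
      x := (hX (γ • x)).hasFDerivAt.comp x (hasFDerivAt_smul_group γ x)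
  have h2 : HasFDerivAt (fun y => X (γ • y)) ((A : Eucl d →L[ℝ] Eucl d).comp (fderiv ℝ X x)) x := by
    have : (fun y => X (γ • y)) = fun y => A (X y) := funext (hequiv γ)
    rw [this]
    exact A.hasFDerivAt.comp x (hX x).hasFDerivAt
  have h3 := h1.unique h2
  rw [divergence_eq_trace, divergence_eq_trace,
    ← LinearMap.trace_conj' (fderiv ℝ X x : Eucl d →ₗ[ℝ] Eucl d) A.toLinearEquiv]
  congr 1
  ext1 v
  have h4 := congrArg (fun L : Eucl d →L[ℝ] Eucl d => L (A.symm v)) h3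
  simpa [LinearEquiv.conj_apply] using h4

theorem divergence_smul {f : Eucl d → ℝ} {X : Eucl d → Eucl d} {x : Eucl d}
    (hf : DifferentiableAt ℝ f x) (hX : DifferentiableAt ℝ X x) :
    divergence (fun y => f y • X y) x = f x * divergence X x + inner ℝ (∇ f x) (X x) := by
  have h := (hf.hasFDerivAt.smul hX.hasFDerivAt).fderiv
  have h' : fderiv ℝ (fun y => f y • X y) x = _ := h
  simp only [divergence]
  rw [h']
  simp only [add_apply, smul_apply,
    ContinuousLinearMap.smulRight_apply, PiLp.add_apply, PiLp.smul_apply, smul_eq_mul,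
    Finset.sum_add_distrib, Finset.mul_sum]
  congr 1
  simp only [gradient, InnerProductSpace.toDual_symm_apply]
  conv_rhs => rw [← (EuclideanSpace.basisFun (Fin d) ℝ).sum_repr (X x)]
  simp [mul_comm]

theorem continuous_divergence {X : Eucl d → Eucl d} (hX : ContDiff ℝ 1 X) :
    Continuous (divergence X) := by
  have h : Continuous (fderiv ℝ X) := hX.continuous_fderiv one_ne_zero
  unfold divergence
  fun_prop

theorem integral_divergence_eq_zero {X : Eucl d → Eucl d} (hX : ContDiff ℝ 1 X)
    (hc : HasCompactSupport X) : ∫ x, divergence X x = 0 := by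
  have hcont : Continuous (fderiv ℝ X) := hX.continuous_fderiv one_ne_zero
  have hint : ∀ i : Fin d, Integrable fun x => (fderiv ℝ X x (EuclideanSpace.single i 1)) i := by
    intro i
    refine Continuous.integrable_of_hasCompactSupport (by fun_prop) ?_
    exact (hc.fderiv (𝕜 := ℝ)).comp_left
      (g := fun L : Eucl d →L[ℝ] Eucl d => (L (EuclideanSpace.single i 1)) i) (by simp)
  unfold divergence
  rw [integral_finsetSum _ fun i _ => hint i]
  refine Finset.sum_eq_zero fun i _ => ?_
  have hXi : ContDiff ℝ 1 fun x => X x i := by fun_prop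
  have hder : ∀ x, fderiv ℝ (fun y => X y i) x (EuclideanSpace.single i 1) =
      (fderiv ℝ X x (EuclideanSpace.single i 1)) i := by
    intro x
    have h1 := ((EuclideanSpace.proj i : Eucl d →L[ℝ] ℝ).hasFDerivAt.comp x
      (hX.differentiable one_ne_zero x).hasFDerivAt).fderiv
    have h2 : fderiv ℝ (fun y => X y i) x = _ := h1
    rw [h2]; rfl
  have hci : HasCompactSupport fun x => X x i :=
    hc.comp_left (g := fun v : Eucl d => v i) (by simp)
  have h := integral_mul_fderiv_eq_neg_fderiv_mul_of_integrable (μ := volume)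
    (f := fun _ : Eucl d => (1 : ℝ)) (g := fun x => X x i) (v := EuclideanSpace.single i 1)
    (by simp) (by simpa only [one_mul, hder] using hint i)
    (by simpa only [one_mul] using hXi.continuous.integrable_of_hasCompactSupport hci)
    (fun x _ => by fun_prop) (fun x _ => (hXi.differentiable one_ne_zero) x)
  simpa [hder] using h

/-- Unfolding: the integral over `ℝ^d` is the integral over a fundamental domain of the sum
over the orbit. -/
theorem integral_eq_setIntegral_tsum [IsIsometricSMul Γ (Eucl d)] [Countable Γ]
    {F : Set (Eucl d)} (hF : IsFundamentalDomain Γ F volume) {g : Eucl d → ℝ} (hg : Integrable g) :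
    ∫ x, g x = ∫ x in F, ∑' γ : Γ, g (γ • x) := by
  have hmp : ∀ γ : Γ, MeasurePreserving (fun x : Eucl d => γ • x) volume volume := fun γ =>
    measurePreserving_smul γ volume
  rw [hF.integral_eq_tsum'' g hg, integral_tsum]
  · intro γ
    exact (hg.aestronglyMeasurable.comp_measurePreserving (hmp γ)).restrict
  · rw [← hF.lintegral_eq_tsum'' (fun x => ‖g x‖ₑ)]
    exact hg.2.ne

section Partition

variable [ProperlyDiscontinuousSMul Γ (Eucl d)]

theorem exists_finset_forall_smul_eq_zero {ψ : Eucl d → ℝ} (hψ : HasCompactSupport ψ)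
    (x : Eucl d) :
    ∃ s : Finset Γ, ∀ y ∈ Metric.ball x 1, ∀ γ ∉ s, ψ (γ • y) = 0 := by
  have hfin := ProperlyDiscontinuousSMul.finite_disjoint_inter_image (Γ := Γ)
    (isCompact_closedBall x 1) hψ.isCompact
  refine ⟨hfin.toFinset, fun y hy γ hγ => ?_⟩
  by_contra hne
  refine hγ (hfin.mem_toFinset.2 ⟨γ • y, ⟨y, Metric.ball_subset_closedBall hy, rfl⟩, ?_⟩)
  exact subset_tsupport _ hne

theorem eventually_tsum_smul_eq_sum {ψ : Eucl d → ℝ} (hψ : HasCompactSupport ψ) (x : Eucl d) :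
    ∃ s : Finset Γ, (∀ᶠ y in nhds x, ∑' γ : Γ, ψ (γ • y) = ∑ γ ∈ s, ψ (γ • y)) ∧
      ∀ γ ∉ s, ∀ᶠ y in nhds x, ψ (γ • y) = 0 := by
  obtain ⟨s, hs⟩ := exists_finset_forall_smul_eq_zero (Γ := Γ) hψ x
  have hb := Metric.ball_mem_nhds x one_pos
  exact ⟨s, Filter.mem_of_superset hb fun y hy => tsum_eq_sum fun γ hγ => hs y hy γ hγ,
    fun γ hγ => Filter.mem_of_superset hb fun y hy => hs y hy γ hγ⟩

/-- A smooth compactly supported function whose translates by `Γ` sum to `1`. -/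
theorem exists_partition_of_unity [IsIsometricSMul Γ (Eucl d)]
    [CompactSpace (FlatQuotient d Γ)] :
    ∃ χ : Eucl d → ℝ, ContDiff ℝ ∞ χ ∧ HasCompactSupport χ ∧
      ∀ x, ∑' γ : Γ, χ (γ • x) = 1 := by
  obtain ⟨K, hK, hsurj⟩ := exists_isCompact_surjOn (d := d) (Γ := Γ)
  obtain ⟨R, hRpos, hR⟩ := hK.isBounded.subset_ball_lt 0 0
  let b : ContDiffBump (0 : Eucl d) := ⟨R, R + 1, hRpos, by linarith⟩
  set Ψ : Eucl d → ℝ := fun x => ∑' γ : Γ, b (γ • x) with hΨ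
  have hcomp := b.hasCompactSupport
  have hΨsmooth : ContDiff ℝ ∞ Ψ := by
    refine contDiff_iff_contDiffAt.2 fun x => ?_
    obtain ⟨s, hs, -⟩ := eventually_tsum_smul_eq_sum (Γ := Γ) hcomp x
    refine ContDiffAt.congr_of_eventuallyEq ?_ hs
    refine ContDiff.contDiffAt (ContDiff.sum fun γ _ => ?_)
    exact b.contDiff.comp (contDiff_smul_group γ)
  have hΨpos : ∀ x, 0 < Ψ x := by
    intro x
    obtain ⟨s, hs, hs'⟩ := eventually_tsum_smul_eq_sum (Γ := Γ) hcomp x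
    obtain ⟨γ, hγ⟩ := hsurj x
    have h1 : b (γ • x) = 1 := b.one_of_mem_closedBall (Metric.ball_subset_closedBall (hR hγ))
    have hmem : γ ∈ s := by
      by_contra hns
      have := (hs' γ hns).self_of_nhds
      rw [h1] at this; exact one_ne_zero this
    have h2 : Ψ x = ∑ γ ∈ s, b (γ • x) := hs.self_of_nhds
    rw [h2]
    exact Finset.sum_pos' (fun i _ => b.nonneg) ⟨γ, hmem, by rw [h1]; exact one_pos⟩
  have hΨinv : ∀ (γ : Γ) x, Ψ (γ • x) = Ψ x := by
    intro γ x
    simp only [hΨ, smul_smul]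
    exact (Equiv.mulRight γ).tsum_eq fun γ' => b (γ' • x)
  refine ⟨fun x => b x / Ψ x, b.contDiff.div hΨsmooth fun x => (hΨpos x).ne', ?_, fun x => ?_⟩
  · refine hcomp.mono fun x hx => ?_
    contrapose! hx
    simp only [Function.mem_support, not_not] at hx ⊢
    simp [hx]
  · simp only [hΨinv]
    rw [tsum_div_const]
    exact div_self (hΨpos x).ne'

/-- The **divergence theorem** on the closed manifold `Θ`, for `C¹` vector fields given by
their `Γ`-equivariant lifts. -/
theorem setIntegral_divergence_eq_zero [IsIsometricSMul Γ (Eucl d)]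
    [CompactSpace (FlatQuotient d Γ)] {F : Set (Eucl d)} (hF : IsFundamentalDomain Γ F volume)
    {X : Eucl d → Eucl d} (hX : ContDiff ℝ 1 X)
    (hequiv : ∀ (γ : Γ) x, X (γ • x) = linPart d γ (X x)) :
    ∫ x in F, divergence X x = 0 := by
  have := countable_group (d := d) (Γ := Γ)
  obtain ⟨χ, hχ, hχc, hχsum⟩ := exists_partition_of_unity (d := d) (Γ := Γ)
  have hχ1 : ContDiff ℝ 1 χ := hχ.of_le (by norm_cast)
  have hdχ : Differentiable ℝ χ := hχ1.differentiable one_ne_zero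
  have hdX : Differentiable ℝ X := hX.differentiable one_ne_zero
  have hYc : HasCompactSupport fun y => χ y • X y := hχc.smul_right
  have hY : ContDiff ℝ 1 fun y => χ y • X y := hχ1.smul hX
  have hYint : Integrable (divergence fun y => χ y • X y) := by
    refine (continuous_divergence hY).integrable_of_hasCompactSupport ?_
    exact (hYc.fderiv (𝕜 := ℝ)).comp_left
      (g := fun L : Eucl d →L[ℝ] Eucl d => ∑ i : Fin d, (L (EuclideanSpace.single i 1)) i)
      (by simp)
  have h0 := integral_divergence_eq_zero hY hYc
  rw [integral_eq_setIntegral_tsum hF hYint] at h0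
  rw [← h0]
  congr 1
  funext x
  obtain ⟨s, hs, hs'⟩ := eventually_tsum_smul_eq_sum (Γ := Γ) hχc x
  have hterm : ∀ γ : Γ, divergence (fun y => χ y • X y) (γ • x) =
      χ (γ • x) * divergence X x + fderiv ℝ (fun y => χ (γ • y)) x (X x) := by
    intro γ
    rw [divergence_smul (hdχ _) (hdX _), divergence_smul_group hdX hequiv]
    congr 1
    have h1 : fderiv ℝ (fun y => χ (γ • y)) x = _ :=
      ((hdχ (γ • x)).hasFDerivAt.comp x (hasFDerivAt_smul_group γ x)).fderiv
    rw [h1, hequiv]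
    simp [gradient]
  rw [tsum_congr hterm, tsum_eq_sum (s := s), Finset.sum_add_distrib, ← Finset.sum_mul]
  · have hsum : ∑ γ ∈ s, χ (γ • x) = 1 := by rw [← hs.self_of_nhds, hχsum]
    -- the translates of `χ` sum to a constant, so their derivatives sum to zero
    have hder : ∑ γ ∈ s, fderiv ℝ (fun y => χ (γ • y)) x = 0 := by
      have hdiff : ∀ γ ∈ s, DifferentiableAt ℝ (fun y => χ (γ • y)) x := fun γ _ =>
        (hdχ.comp ((contDiff_smul_group γ).differentiable (by simp))) x
      rw [← fderiv_fun_sum hdiff]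
      have hone : (fun y => ∑ γ ∈ s, χ (γ • y)) =ᶠ[nhds x] fun _ => (1 : ℝ) :=
        hs.mono fun y hy => hy.symm.trans (hχsum y)
      rw [hone.fderiv_eq]
      simp
    have hder' := congrArg (fun L : Eucl d →L[ℝ] ℝ => L (X x)) hder
    simp only [sum_apply, zero_apply] at hder'
    rw [hsum, hder']; simp
  · intro γ hγ
    have hz : (fun y => χ (γ • y)) =ᶠ[nhds x] fun _ => (0 : ℝ) := hs' γ hγ
    rw [hz.fderiv_eq, (hs' γ hγ).self_of_nhds]
    simp

/-- **Integration by parts** on `Θ`. -/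
theorem setIntegral_mul_divergence [IsIsometricSMul Γ (Eucl d)]
    [CompactSpace (FlatQuotient d Γ)] {F : Set (Eucl d)} (hF : IsFundamentalDomain Γ F volume)
    {f : Eucl d → ℝ} (hf : ContDiff ℝ 1 f) (hinv : ∀ (γ : Γ) x, f (γ • x) = f x)
    {X : Eucl d → Eucl d} (hX : ContDiff ℝ 1 X)
    (hequiv : ∀ (γ : Γ) x, X (γ • x) = linPart d γ (X x)) :
    ∫ x in F, (f x * divergence X x + inner ℝ (∇ f x) (X x)) = 0 := by
  rw [← setIntegral_divergence_eq_zero hF (hf.smul hX) (fun γ x => by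
    rw [Pi.smul_apply', Pi.smul_apply', hinv, hequiv, map_smul])]
  congr 1
  funext x
  exact (divergence_smul (hf.differentiable one_ne_zero x)
    (hX.differentiable one_ne_zero x)).symm

end Partition

/-! ### Mollification and the log-Sobolev inequality for `C¹` functions -/

theorem exists_radial_mollifier (d : ℕ) :
    ∃ φ : Eucl d → ℝ, ContDiff ℝ ∞ φ ∧ HasCompactSupport φ ∧ (∀ x, 0 ≤ φ x) ∧ ∫ x, φ x = 1 ∧
      ∀ (L : Eucl d ≃ₗᵢ[ℝ] Eucl d) x, φ (L x) = φ x := by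
  set φ₀ : Eucl d → ℝ := fun x => Real.smoothTransition (1 - ‖x‖ ^ 2) with hφ₀
  have hsm : ContDiff ℝ ∞ φ₀ :=
    Real.smoothTransition.contDiff.comp (contDiff_const.sub (contDiff_norm_sq ℝ))
  have hc : HasCompactSupport φ₀ := by
    refine HasCompactSupport.intro (isCompact_closedBall (0 : Eucl d) 1) fun x hx => ?_
    have hx' : 1 < ‖x‖ := by simpa using hx
    exact Real.smoothTransition.zero_of_nonpos (by nlinarith)
  have hnn : ∀ x, 0 ≤ φ₀ x := fun x => Real.smoothTransition.nonneg _
  have hpos : 0 < ∫ x, φ₀ x :=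
    hsm.continuous.integral_pos_of_hasCompactSupport_nonneg_nonzero hc hnn (x := 0)
      (by simp [hφ₀])
  refine ⟨fun x => φ₀ x / ∫ y, φ₀ y, hsm.div_const _, ?_,
    fun x => div_nonneg (hnn x) hpos.le, ?_, fun L x => by simp [hφ₀]⟩
  · exact hc.comp_left (g := fun r => r / ∫ y, φ₀ y) (by simp)
  · rw [integral_div, div_self hpos.ne']

section Mollify

variable {φ : Eucl d → ℝ}

/-- The average of `f` near `x` at scale `s`, with weight `φ`. For radial `φ` it commutes with
Euclidean isometries. -/
def mollify {G : Type*} [NormedAddCommGroup G] [NormedSpace ℝ G] (φ : Eucl d → ℝ) (s : ℝ)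
    (f : Eucl d → G) (x : Eucl d) : G := ∫ y, φ y • f (x - s • y)

theorem norm_mollify_le {G : Type*} [NormedAddCommGroup G] [NormedSpace ℝ G]
    (hφ : Integrable φ) (hnn : ∀ x, 0 ≤ φ x) (hone : ∫ x, φ x = 1)
    {f : Eucl d → G} {C : ℝ} (hC : ∀ x, ‖f x‖ ≤ C) (s : ℝ) (x : Eucl d) :
    ‖mollify φ s f x‖ ≤ C := by
  have h := norm_integral_le_of_norm_le (μ := volume) (f := fun y => φ y • f (x - s • y))
    (hφ.mul_const C) (Filter.Eventually.of_forall fun y => by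
      rw [norm_smul, Real.norm_of_nonneg (hnn y)]
      exact mul_le_mul_of_nonneg_left (hC _) (hnn y))
  rwa [integral_mul_const, hone, one_mul] at h

theorem tendsto_mollify {G : Type*} [NormedAddCommGroup G] [NormedSpace ℝ G]
    [CompleteSpace G] [SecondCountableTopology G] [MeasurableSpace G] [BorelSpace G]
    (hφ : Integrable φ) (hnn : ∀ x, 0 ≤ φ x) (hone : ∫ x, φ x = 1)
    {f : Eucl d → G} (hf : Continuous f) {C : ℝ} (hC : ∀ x, ‖f x‖ ≤ C)
    {s : ℕ → ℝ} (hs : Filter.Tendsto s Filter.atTop (nhds 0)) (x : Eucl d) :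
    Filter.Tendsto (fun n => mollify φ (s n) f x) Filter.atTop (nhds (f x)) := by
  have hlim : f x = ∫ y, φ y • f x := by rw [integral_smul_const, hone, one_smul]
  rw [hlim]
  refine tendsto_integral_of_dominated_convergence (fun y => φ y * C) (fun n => ?_)
    (hφ.mul_const C) (fun n => Filter.Eventually.of_forall fun y => ?_)
    (Filter.Eventually.of_forall fun y => ?_)
  · exact hφ.aestronglyMeasurable.smul (by fun_prop)
  · rw [norm_smul, Real.norm_of_nonneg (hnn y)]
    exact mul_le_mul_of_nonneg_left (hC _) (hnn y)
  · refine Filter.Tendsto.const_smul ?_ _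
    refine (hf.tendsto x).comp ?_
    simpa using (tendsto_const_nhds (x := x)).sub (hs.smul_const y)

theorem mollify_smul [IsIsometricSMul Γ (Eucl d)]
    (hrad : ∀ (L : Eucl d ≃ₗᵢ[ℝ] Eucl d) x, φ (L x) = φ x)
    {f : Eucl d → ℝ} (hf : ∀ (γ : Γ) x, f (γ • x) = f x) (s : ℝ) (γ : Γ) (x : Eucl d) :
    mollify φ s f (γ • x) = mollify φ s f x := by
  have hmp := (linPart d γ).measurePreserving
  have hemb := (linPart d γ).toMeasurableEquiv.measurableEmbedding
  unfold mollify
  rw [← hmp.integral_comp hemb]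
  refine integral_congr_ae (Filter.Eventually.of_forall fun y => ?_)
  have h : γ • x - s • (linPart d γ) y = γ • (x - s • y) := by
    rw [sub_eq_add_neg x, smul_add_eq, map_neg, map_smul, sub_eq_add_neg]
  simp only [hrad, h, hf]

theorem contDiff_mollify (hφs : ContDiff ℝ ∞ φ) (hφc : HasCompactSupport φ)
    {f : Eucl d → ℝ} (hf : Continuous f) {s : ℝ} (hs : s ≠ 0) :
    ContDiff ℝ ∞ (mollify φ s f) := by
  have hφs' : ContDiff ℝ ∞ fun z : Eucl d => φ (s⁻¹ • z) := hφs.comp (contDiff_const_smul _)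
  have hφc' : HasCompactSupport fun z : Eucl d => φ (s⁻¹ • z) :=
    hφc.comp_homeomorph (Homeomorph.smulOfNeZero s⁻¹ (inv_ne_zero hs))
  set L : ℝ →L[ℝ] ℝ →L[ℝ] ℝ := ContinuousLinearMap.lsmul ℝ ℝ with hL
  have hconv := hφc'.contDiff_convolution_left L hφs' (hf.locallyIntegrable (μ := volume))
  have heq : mollify φ s f = fun x => |(s ^ Module.finrank ℝ (Eucl d))⁻¹| •
      (convolution (fun z : Eucl d => φ (s⁻¹ • z)) f L volume x) := by
    funext x
    rw [convolution, ← Measure.integral_comp_smul]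
    refine integral_congr_ae (Filter.Eventually.of_forall fun y => ?_)
    simp [hL, smul_smul, inv_mul_cancel₀ hs]
  rw [heq]
  exact ContDiff.const_smul (|(s ^ Module.finrank ℝ (Eucl d))⁻¹|) hconv

theorem hasFDerivAt_mollify (hφ : Integrable φ) (hnn : ∀ x, 0 ≤ φ x)
    {f : Eucl d → ℝ} (hf : ContDiff ℝ 1 f) {C C' : ℝ} (hC : ∀ x, ‖f x‖ ≤ C)
    (hC' : ∀ x, ‖fderiv ℝ f x‖ ≤ C') (s : ℝ) (x : Eucl d) :
    HasFDerivAt (mollify φ s f) (mollify φ s (fderiv ℝ f) x) x := by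
  have hcont := hf.continuous
  have hcont' : Continuous (fderiv ℝ f) := hf.continuous_fderiv one_ne_zero
  refine hasFDerivAt_integral_of_dominated_of_fderiv_le (s := univ)
    (F := fun x y => φ y • f (x - s • y)) (F' := fun x y => φ y • fderiv ℝ f (x - s • y))
    (bound := fun y => φ y * C') Filter.univ_mem
    (Filter.Eventually.of_forall fun x => hφ.aestronglyMeasurable.smul (by fun_prop)) ?_
    (hφ.aestronglyMeasurable.smul (by fun_prop))
    (Filter.Eventually.of_forall fun y x _ => ?_) (hφ.mul_const C')
    (Filter.Eventually.of_forall fun y x _ => ?_)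
  · refine (hφ.mul_const C).mono' (hφ.aestronglyMeasurable.smul (by fun_prop))
      (Filter.Eventually.of_forall fun y => ?_)
    rw [norm_smul, Real.norm_of_nonneg (hnn y)]
    exact mul_le_mul_of_nonneg_left (hC _) (hnn y)
  · rw [norm_smul, Real.norm_of_nonneg (hnn y)]
    exact mul_le_mul_of_nonneg_left (hC' _) (hnn y)
  · have h1 := (hf.differentiable one_ne_zero (x - s • y)).hasFDerivAt
    have h2 : HasFDerivAt (fun x : Eucl d => x - s • y) (ContinuousLinearMap.id ℝ (Eucl d)) x :=
      (hasFDerivAt_id x).sub_const _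
    exact (h1.comp x h2).const_smul (φ y)

end Mollify

section LogSobolev

variable [IsIsometricSMul Γ (Eucl d)]

theorem norm_gradient (f : Eucl d → ℝ) (x : Eucl d) : ‖∇ f x‖ = ‖fderiv ℝ f x‖ :=
  LinearIsometryEquiv.norm_map _ _

theorem lift_gradNorm (f : FlatQuotient d Γ → ℝ) :
    lift (gradNorm f) = fun x => ‖∇ (lift f) x‖ := rfl

theorem continuous_lift_gradNorm {f : FlatQuotient d Γ → ℝ} (hf : ContDiff ℝ 1 (lift f)) :
    Continuous (lift (gradNorm f)) := by
  rw [lift_gradNorm]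
  simp only [norm_gradient]
  exact (hf.continuous_fderiv one_ne_zero).norm

theorem gradNorm_const_mul {f : FlatQuotient d Γ → ℝ} (hf : Differentiable ℝ (lift f)) (a : ℝ)
    (θ : FlatQuotient d Γ) : gradNorm (fun η => a * f η) θ = |a| * gradNorm f θ := by
  obtain ⟨x, rfl⟩ := cover_surjective θ
  change ‖∇ (fun y => a * lift f y) x‖ = |a| * ‖∇ (lift f) x‖
  rw [norm_gradient, norm_gradient, fderiv_const_mul (hf x), norm_smul, Real.norm_eq_abs]

theorem continuous_sq_mul_log_sq : Continuous fun r : ℝ => r ^ 2 * Real.log (r ^ 2) :=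
  Real.continuous_mul_log.comp (continuous_pow 2)

/-- The log-Sobolev inequality without the normalization of `f`. -/
theorem SatisfiesLSI.integral_sq_mul_log_sq_le [CompactSpace (FlatQuotient d Γ)]
    {μ : Measure (FlatQuotient d Γ)} [IsFiniteMeasure μ] {l : ℝ} (h : SatisfiesLSI μ l)
    {f : FlatQuotient d Γ → ℝ} (hf : ContDiff ℝ ∞ (lift f)) (hpos : 0 < ∫ θ, f θ ^ 2 ∂μ) :
    ∫ θ, f θ ^ 2 * Real.log (f θ ^ 2) ∂μ ≤
      (∫ θ, f θ ^ 2 ∂μ) * Real.log (∫ θ, f θ ^ 2 ∂μ) + 2 / l * ∫ θ, gradNorm f θ ^ 2 ∂μ := by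
  set c := ∫ θ, f θ ^ 2 ∂μ with hc
  set a := (√c)⁻¹ with ha
  have ha2 : a ^ 2 = c⁻¹ := by rw [ha, inv_pow, Real.sq_sqrt hpos.le]
  have hcont := hf.continuous
  have hsm : ContDiff ℝ ∞ (lift fun θ => a * f θ) := contDiff_const.mul hf
  have hone : ∫ θ, (a * f θ) ^ 2 ∂μ = 1 := by
    simp only [mul_pow]
    rw [integral_const_mul, ← hc, ha2, inv_mul_cancel₀ hpos.ne']
  have key := h _ hsm hone
  have e1 : ∀ θ, (a * f θ) ^ 2 * Real.log ((a * f θ) ^ 2) =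
      c⁻¹ * (f θ ^ 2 * Real.log (f θ ^ 2) - Real.log c * f θ ^ 2) := by
    intro θ
    rw [mul_pow, ha2]
    by_cases h0 : f θ = 0
    · simp [h0]
    · rw [Real.log_mul (inv_ne_zero hpos.ne') (pow_ne_zero 2 h0), Real.log_inv]; ring
  have e2 : ∀ θ, gradNorm (fun η => a * f η) θ ^ 2 = c⁻¹ * gradNorm f θ ^ 2 := by
    intro θ
    rw [gradNorm_const_mul (hf.differentiable (by simp)), mul_pow, sq_abs, ha2]
  simp only [e1, e2] at key
  rw [integral_const_mul, integral_const_mul, integral_sub, integral_const_mul, ← hc] at key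
  · have := mul_le_mul_of_nonneg_left key hpos.le
    rw [← mul_assoc, mul_inv_cancel₀ hpos.ne', one_mul] at this
    have e3 : ∀ I : ℝ, c * (2 / l * (c⁻¹ * I)) = 2 / l * I := fun I => by
      field_simp
    rw [e3] at this
    linarith
  · exact integrable_of_continuous_lift (continuous_sq_mul_log_sq.comp hcont)
  · exact integrable_of_continuous_lift (continuous_const.mul (hcont.pow 2))

/-- The log-Sobolev inequality for smooth functions extends to `C¹` functions by mollification. -/
theorem SatisfiesLSI.integral_sq_mul_log_sq_le_of_contDiff_one
    [CompactSpace (FlatQuotient d Γ)]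
    {μ : Measure (FlatQuotient d Γ)} [IsFiniteMeasure μ] {l : ℝ} (h : SatisfiesLSI μ l)
    {f : FlatQuotient d Γ → ℝ} (hf : ContDiff ℝ 1 (lift f)) (hpos : 0 < ∫ θ, f θ ^ 2 ∂μ) :
    ∫ θ, f θ ^ 2 * Real.log (f θ ^ 2) ∂μ ≤
      (∫ θ, f θ ^ 2 ∂μ) * Real.log (∫ θ, f θ ^ 2 ∂μ) + 2 / l * ∫ θ, gradNorm f θ ^ 2 ∂μ := by
  obtain ⟨φ, hφs, hφc, hnn, hone, hrad⟩ := exists_radial_mollifier d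
  have hφ : Integrable φ := hφs.continuous.integrable_of_hasCompactSupport hφc
  have hcont := hf.continuous
  obtain ⟨C, hC⟩ := exists_bound_of_continuous_lift hcont
  obtain ⟨C', hC'⟩ := exists_bound_of_continuous_lift (continuous_lift_gradNorm hf)
  have hbf : ∀ x, ‖lift f x‖ ≤ C := fun x => hC _
  have hbg : ∀ x, ‖fderiv ℝ (lift f) x‖ ≤ C' := fun x => by
    rw [← norm_gradient]; exact (le_abs_self _).trans (hC' (cover d Γ x))
  set s : ℕ → ℝ := fun n => 1 / ((n : ℝ) + 1) with hs
  have hs0 : ∀ n, s n ≠ 0 := fun n => by positivity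
  have hslim : Filter.Tendsto s Filter.atTop (nhds 0) := tendsto_one_div_add_atTop_nhds_zero_nat
  set g : ℕ → FlatQuotient d Γ → ℝ := fun n => descend (mollify φ (s n) (lift f)) with hg
  have hlift : ∀ n, lift (g n) = mollify φ (s n) (lift f) := fun n =>
    lift_descend fun γ x => mollify_smul hrad (fun γ x => lift_smul f γ x) _ γ x
  have hgs : ∀ n, ContDiff ℝ ∞ (lift (g n)) := fun n => by
    rw [hlift]; exact contDiff_mollify hφs hφc hcont (hs0 n)
  have hgb : ∀ n θ, |g n θ| ≤ C := by
    intro n θ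
    obtain ⟨x, rfl⟩ := cover_surjective θ
    change ‖lift (g n) x‖ ≤ C
    rw [hlift]
    exact norm_mollify_le hφ hnn hone hbf _ _
  have hgrad : ∀ n x, gradNorm (g n) (cover d Γ x) = ‖mollify φ (s n) (fderiv ℝ (lift f)) x‖ := by
    intro n x
    change ‖∇ (lift (g n)) x‖ = _
    rw [norm_gradient, hlift, (hasFDerivAt_mollify hφ hnn hf hbf hbg (s n) x).fderiv]
  have hglim : ∀ θ, Filter.Tendsto (fun n => g n θ) Filter.atTop (nhds (f θ)) := by
    intro θ
    obtain ⟨x, rfl⟩ := cover_surjective θ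
    change Filter.Tendsto (fun n => lift (g n) x) _ (nhds (lift f x))
    simp only [hlift]
    exact tendsto_mollify hφ hnn hone hcont hbf hslim x
  have hgradlim : ∀ θ, Filter.Tendsto (fun n => gradNorm (g n) θ) Filter.atTop
      (nhds (gradNorm f θ)) := by
    intro θ
    obtain ⟨x, rfl⟩ := cover_surjective θ
    simp only [hgrad]
    change Filter.Tendsto _ _ (nhds ‖∇ (lift f) x‖)
    rw [norm_gradient]
    exact (tendsto_mollify hφ hnn hone (hf.continuous_fderiv one_ne_zero) hbg hslim x).norm
  have hgradb : ∀ n θ, |gradNorm (g n) θ| ≤ C' := by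
    intro n θ
    obtain ⟨x, rfl⟩ := cover_surjective θ
    rw [hgrad, abs_norm]
    exact norm_mollify_le hφ hnn hone hbg _ _
  have hlim_comp : ∀ F : ℝ → ℝ, Continuous F → Filter.Tendsto (fun n => ∫ θ, F (g n θ) ∂μ)
      Filter.atTop (nhds (∫ θ, F (f θ) ∂μ)) := by
    intro F hF
    obtain ⟨M, hM⟩ := (isCompact_Icc (a := -C) (b := C)).exists_bound_of_continuousOn
      hF.continuousOn
    refine tendsto_integral_of_dominated_convergence (fun _ => M) (fun n => ?_)
      (integrable_const M) (fun n => Filter.Eventually.of_forall fun θ => ?_)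
      (Filter.Eventually.of_forall fun θ => (hF.tendsto _).comp (hglim θ))
    · exact (hF.measurable.comp
        (measurable_of_continuous_lift (hgs n).continuous)).aestronglyMeasurable
    · exact hM _ (abs_le.1 (hgb n θ))
  have h1 := hlim_comp _ (continuous_pow 2)
  have h2 := hlim_comp _ continuous_sq_mul_log_sq
  have h3 : Filter.Tendsto (fun n => ∫ θ, gradNorm (g n) θ ^ 2 ∂μ) Filter.atTop
      (nhds (∫ θ, gradNorm f θ ^ 2 ∂μ)) := by
    refine tendsto_integral_of_dominated_convergence (fun _ => C' ^ 2) (fun n => ?_)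
      (integrable_const _) (fun n => Filter.Eventually.of_forall fun θ => ?_)
      (Filter.Eventually.of_forall fun θ => (hgradlim θ).pow 2)
    · exact ((measurable_of_continuous_lift (continuous_lift_gradNorm
        ((hgs n).of_le (by norm_cast)))).pow_const 2).aestronglyMeasurable
    · rw [Real.norm_of_nonneg (sq_nonneg _), ← sq_abs]
      exact pow_le_pow_left₀ (abs_nonneg _) (hgradb n θ) 2
  refine le_of_tendsto_of_tendsto h2
    (((Real.continuous_mul_log.tendsto _).comp h1).add (h3.const_mul (2 / l))) ?_
  filter_upwards [h1.eventually (lt_mem_nhds hpos)] with n hn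
  exact h.integral_sq_mul_log_sq_le (hgs n) hn

end LogSobolev

/-! ### Privacy from relative entropy, Gibbs densities and the Holley–Stroock argument -/

section Density

variable {F : Set (Eucl d)} {p q V : FlatQuotient d Γ → ℝ}

theorem integral_densityMeasure (hp : Measurable p) (hpos : ∀ θ, 0 ≤ p θ)
    (f : FlatQuotient d Γ → ℝ) :
    ∫ θ, f θ ∂(densityMeasure F p) = ∫ θ, p θ * f θ ∂(vol F) := by
  unfold densityMeasure
  rw [integral_withDensity_eq_integral_toReal_smul hp.ennreal_ofReal
    (Filter.Eventually.of_forall fun _ => ENNReal.ofReal_lt_top)]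
  simp only [ENNReal.toReal_ofReal (hpos _), smul_eq_mul]

theorem densityMeasure_real_apply (hp : Measurable p) (hpos : ∀ θ, 0 ≤ p θ)
    {S : Set (FlatQuotient d Γ)} (hS : MeasurableSet S) :
    (densityMeasure F p).real S = ∫ θ in S, p θ ∂(vol F) := by
  rw [Measure.real, densityMeasure, withDensity_apply _ hS,
    integral_eq_lintegral_of_nonneg_ae (Filter.Eventually.of_forall hpos)
      hp.aestronglyMeasurable]

theorem isProbabilityMeasure_densityMeasure (hp : Integrable p (vol F)) (hpos : ∀ θ, 0 ≤ p θ)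
    (hone : ∫ θ, p θ ∂(vol F) = 1) : IsProbabilityMeasure (densityMeasure F p) := by
  refine ⟨?_⟩
  rw [densityMeasure, withDensity_apply _ MeasurableSet.univ, Measure.restrict_univ,
    ← ofReal_integral_eq_lintegral_ofReal hp (Filter.Eventually.of_forall hpos), hone,
    ENNReal.ofReal_one]

theorem integral_pos_of_continuous_lift [CompactSpace (FlatQuotient d Γ)]
    {μ : Measure (FlatQuotient d Γ)} [IsFiniteMeasure μ] (hμ : μ ≠ 0)
    {f : FlatQuotient d Γ → ℝ} (hf : Continuous (lift f)) (hpos : ∀ θ, 0 < f θ) :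
    0 < ∫ θ, f θ ∂μ := by
  rw [integral_pos_iff_support_of_nonneg (fun θ => (hpos θ).le)
    (integrable_of_continuous_lift hf)]
  have : Function.support f = univ := eq_univ_of_forall fun θ => (hpos θ).ne'
  rw [this]
  exact (Measure.measure_univ_pos).2 hμ

/-- The excess of `a` over `e^ε b` is at most `1 / ε` times the integrand of the Kullback–Leibler
divergence, corrected by `b - a` so as to be nonnegative. -/
theorem sub_exp_mul_le {a b ε : ℝ} (ha : 0 < a) (hb : 0 < b) (hε : 0 < ε) :
    a - Real.exp ε * b ≤ (a * (Real.log a - Real.log b) - a + b) / ε := by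
  set h := Real.log a - Real.log b with hh
  have hbh : b = a * Real.exp (-h) := by
    rw [hh, neg_sub, Real.exp_sub, Real.exp_log ha, Real.exp_log hb]; field_simp
  -- after division by `a`, the right side minus the left side is minimal at `h = K`
  set K := Real.log (1 + ε * Real.exp ε) with hK
  have hKexp : Real.exp K = 1 + ε * Real.exp ε := Real.exp_log (by positivity)
  have hKε : ε ≤ K := by
    rw [hK, Real.le_log_iff_exp_le (by positivity)]
    have h1 := Real.add_one_le_exp (-ε)
    have h2 : Real.exp (-ε) * Real.exp ε = 1 := by rw [← Real.exp_add]; simp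
    nlinarith [Real.exp_pos ε]
  have h1 := Real.add_one_le_exp (-h + K)
  rw [Real.exp_add, hKexp] at h1
  rw [le_div_iff₀ hε, hbh]
  have h3 : 0 ≤ a * (Real.exp (-h) * (1 + ε * Real.exp ε) + h - 1 - ε) :=
    mul_nonneg ha.le (by linarith)
  linarith

theorem mul_log_sub_log_sub_add_nonneg {a b : ℝ} (ha : 0 < a) (hb : 0 < b) :
    0 ≤ a * (Real.log a - Real.log b) - a + b := by
  have h := Real.log_le_sub_one_of_pos (div_pos hb ha)
  rw [Real.log_div hb.ne' ha.ne'] at h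
  have h2 : a * (b / a) = b := by field_simp
  nlinarith

/-- A Kullback–Leibler divergence at most `H` gives `(ε, H / ε)`-indistinguishability. -/
theorem densityMeasure_real_le_of_klDiv_le [CompactSpace (FlatQuotient d Γ)]
    [IsFiniteMeasure (vol F : Measure (FlatQuotient d Γ))]
    (hp : Continuous (lift p)) (hq : Continuous (lift q)) (hppos : ∀ θ, 0 < p θ)
    (hqpos : ∀ θ, 0 < q θ) (hp1 : ∫ θ, p θ ∂(vol F) = 1) (hq1 : ∫ θ, q θ ∂(vol F) = 1)
    {H : ℝ} (hH : ∫ θ, p θ * (Real.log (p θ) - Real.log (q θ)) ∂(vol F) ≤ H)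
    {ε : ℝ} (hε : 0 < ε) {S : Set (FlatQuotient d Γ)} (hS : MeasurableSet S) :
    (densityMeasure F p).real S ≤ Real.exp ε * (densityMeasure F q).real S + H / ε := by
  have hlp : Continuous (lift fun θ => Real.log (p θ)) := hp.log fun x => (hppos _).ne'
  have hlq : Continuous (lift fun θ => Real.log (q θ)) := hq.log fun x => (hqpos _).ne'
  have ip : Integrable p (vol F) := integrable_of_continuous_lift hp
  have iq : Integrable q (vol F) := integrable_of_continuous_lift hq
  have ih : Integrable (fun θ => p θ * (Real.log (p θ) - Real.log (q θ))) (vol F) :=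
    integrable_of_continuous_lift (hp.mul (hlp.sub hlq))
  have ik : Integrable (fun θ => (p θ * (Real.log (p θ) - Real.log (q θ)) - p θ + q θ) / ε)
    (vol F) := ((ih.sub ip).add iq).div_const ε
  rw [densityMeasure_real_apply (measurable_of_continuous_lift hp) (fun θ => (hppos θ).le) hS,
    densityMeasure_real_apply (measurable_of_continuous_lift hq) (fun θ => (hqpos θ).le) hS,
    ← sub_le_iff_le_add', ← integral_const_mul,
    ← integral_sub ip.integrableOn (iq.const_mul _).integrableOn]
  calc ∫ θ in S, (p θ - Real.exp ε * q θ) ∂(vol F)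
      ≤ ∫ θ in S, (p θ * (Real.log (p θ) - Real.log (q θ)) - p θ + q θ) / ε ∂(vol F) :=
        integral_mono (ip.sub (iq.const_mul _)).integrableOn ik.integrableOn
          fun θ => sub_exp_mul_le (hppos θ) (hqpos θ) hε
    _ ≤ ∫ θ, (p θ * (Real.log (p θ) - Real.log (q θ)) - p θ + q θ) / ε ∂(vol F) :=
        setIntegral_le_integral ik (Filter.Eventually.of_forall fun θ =>
          div_nonneg (mul_log_sub_log_sub_add_nonneg (hppos θ) (hqpos θ)) hε.le)
    _ ≤ H / ε := by
        rw [integral_div, integral_add (ih.sub' ip) iq, integral_sub ih ip, hp1, hq1]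
        have : (∫ θ, p θ * (Real.log (p θ) - Real.log (q θ)) ∂(vol F)) - 1 + 1 ≤ H := by linarith
        exact div_le_div_of_nonneg_right this hε.le

end Density

section Gibbs

theorem continuous_lift_gibbs {F : Set (Eucl d)} {V : FlatQuotient d Γ → ℝ}
    (hV : Continuous (lift V)) :
    Continuous (lift (gibbs F V)) :=
  (Real.continuous_exp.comp hV.neg).div_const _

variable [CompactSpace (FlatQuotient d Γ)] {F : Set (Eucl d)}
  [IsFiniteMeasure (vol F : Measure (FlatQuotient d Γ))]
  {V : FlatQuotient d Γ → ℝ}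

theorem integral_exp_neg_pos (hvol : (vol F : Measure (FlatQuotient d Γ)) ≠ 0)
    (hV : Continuous (lift V)) : 0 < ∫ η, Real.exp (-V η) ∂(vol F) :=
  integral_pos_of_continuous_lift hvol (f := fun θ => Real.exp (-V θ))
    (Real.continuous_exp.comp hV.neg) fun _ => Real.exp_pos _

theorem gibbs_pos (hvol : (vol F : Measure (FlatQuotient d Γ)) ≠ 0)
    (hV : Continuous (lift V)) (θ : FlatQuotient d Γ) : 0 < gibbs F V θ :=
  div_pos (Real.exp_pos _) (integral_exp_neg_pos hvol hV)

theorem log_gibbs (hvol : (vol F : Measure (FlatQuotient d Γ)) ≠ 0)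
    (hV : Continuous (lift V)) (θ : FlatQuotient d Γ) :
    Real.log (gibbs F V θ) = -V θ - Real.log (∫ η, Real.exp (-V η) ∂(vol F)) := by
  rw [gibbs, Real.log_div (Real.exp_ne_zero _) (integral_exp_neg_pos hvol hV).ne', Real.log_exp]

theorem integral_gibbs (hvol : (vol F : Measure (FlatQuotient d Γ)) ≠ 0)
    (hV : Continuous (lift V)) : ∫ θ, gibbs F V θ ∂(vol F) = 1 := by
  unfold gibbs
  rw [integral_div, div_self (integral_exp_neg_pos hvol hV).ne']

/-- The log-ratio of two Gibbs densities is at most the oscillation of the difference of the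
potentials: the ratio of the normalizing constants is an average of `exp (V - V')`. -/
theorem abs_log_gibbs_div_gibbs_le (hvol : (vol F : Measure (FlatQuotient d Γ)) ≠ 0)
    {V' : FlatQuotient d Γ → ℝ} (hV : Continuous (lift V)) (hV' : Continuous (lift V'))
    {δ : ℝ} (hδ : ∀ θ η, (V θ - V' θ) - (V η - V' η) ≤ δ) (θ : FlatQuotient d Γ) :
    |Real.log (gibbs F V θ / gibbs F V' θ)| ≤ δ := by
  have hZ := integral_exp_neg_pos hvol hV
  have hZ' := integral_exp_neg_pos hvol hV'
  have hint : ∀ {W : FlatQuotient d Γ → ℝ}, Continuous (lift W) →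
      Integrable (fun η => Real.exp (-W η)) (vol F) := fun hW =>
    integrable_of_continuous_lift (Real.continuous_exp.comp hW.neg)
  have hle : ∀ {W W' : FlatQuotient d Γ → ℝ} {a : ℝ}, Continuous (lift W) →
      Continuous (lift W') → (∀ η, W η - W' η ≤ a) →
      Real.log (∫ η, Real.exp (-W' η) ∂(vol F)) ≤
        a + Real.log (∫ η, Real.exp (-W η) ∂(vol F)) := by
    intro W W' a hW hW' ha
    have hpos := integral_exp_neg_pos hvol hW
    rw [← Real.log_exp a, ← Real.log_mul (Real.exp_ne_zero _) hpos.ne', ← integral_const_mul]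
    refine Real.log_le_log (integral_exp_neg_pos hvol hW')
      (integral_mono (hint hW') ((hint hW).const_mul _) fun η => ?_)
    simp only [← Real.exp_add]
    exact Real.exp_le_exp.2 (by linarith [ha η])
  rw [Real.log_div (gibbs_pos hvol hV θ).ne' (gibbs_pos hvol hV' θ).ne', log_gibbs hvol hV,
    log_gibbs hvol hV', abs_le]
  have h1 := hle (a := δ + (V θ - V' θ)) hV hV' fun η => by linarith [hδ η θ]
  have h2 := hle (a := δ - (V θ - V' θ)) hV' hV fun η => by linarith [hδ θ η]
  constructor <;> linarith

/-- The Holley–Stroock perturbation argument: the density `q` inherits a log-Sobolev inequality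
from the Gibbs density of `V` because `q / π` oscillates by a factor of at most `exp B`. It is
applied to the density `p / q` of a second probability density `p`. -/
theorem SatisfiesLSI.klDiv_le_fisher [IsIsometricSMul Γ (Eucl d)]
    (hvol : (vol F : Measure (FlatQuotient d Γ)) ≠ 0)
    (hV : Continuous (lift V)) {l : ℝ} (hl : 0 < l)
    (hLSI : SatisfiesLSI (densityMeasure F (gibbs F V)) l)
    {p q : FlatQuotient d Γ → ℝ} (hp : ContDiff ℝ 1 (lift p)) (hq : ContDiff ℝ 1 (lift q))
    (hppos : ∀ θ, 0 < p θ) (hqpos : ∀ θ, 0 < q θ)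
    (hp1 : ∫ θ, p θ ∂(vol F) = 1) (hq1 : ∫ θ, q θ ∂(vol F) = 1)
    {B : ℝ} (hB : ∀ θ η, (Real.log (q θ) + V θ) - (Real.log (q η) + V η) ≤ B) :
    2 * Real.exp (-B) * l * ∫ θ, p θ * (Real.log (p θ) - Real.log (q θ)) ∂(vol F) ≤
      ∫ θ, p θ * gradNorm (fun η => Real.log (p η) - Real.log (q η)) θ ^ 2 ∂(vol F) := by
  set π := gibbs F V with hπ
  have hπpos : ∀ θ, 0 < π θ := gibbs_pos hvol hV
  have hπc : Continuous (lift π) := continuous_lift_gibbs hV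
  have hπ1 : ∫ θ, π θ ∂(vol F) = 1 := integral_gibbs hvol hV
  have : IsProbabilityMeasure (densityMeasure F π) := isProbabilityMeasure_densityMeasure
    (integrable_of_continuous_lift hπc) (fun θ => (hπpos θ).le) hπ1
  set h : FlatQuotient d Γ → ℝ := fun η => Real.log (p η) - Real.log (q η) with hh
  have hhs : ContDiff ℝ 1 (lift h) :=
    (hp.log fun x => (hppos _).ne').sub (hq.log fun x => (hqpos _).ne')
  set g : FlatQuotient d Γ → ℝ := fun η => Real.exp (h η) with hg
  have hgpos : ∀ θ, 0 < g θ := fun θ => Real.exp_pos _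
  have hgc : Continuous (lift g) := Real.continuous_exp.comp hhs.continuous
  have hqg : ∀ θ, q θ * g θ = p θ := by
    intro θ
    simp only [hg, hh, Real.exp_sub, Real.exp_log (hppos θ), Real.exp_log (hqpos θ)]
    have := (hqpos θ).ne'
    field_simp
  have hGc : Continuous (lift (gradNorm h)) := continuous_lift_gradNorm hhs
  have hhc := hhs.continuous
  have hpc := hp.continuous
  have hqc := hq.continuous
  -- the two-sided comparison of `q` with `π`
  obtain ⟨N, hN, hNq, hqN⟩ : ∃ N : ℝ, 0 < N ∧ (∀ θ, N * π θ ≤ q θ) ∧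
      ∀ θ, q θ ≤ Real.exp B * N * π θ := by
    set Z := ∫ η, Real.exp (-V η) ∂(vol F) with hZ
    have hZpos : 0 < Z := integral_exp_neg_pos hvol hV
    set w : FlatQuotient d Γ → ℝ := fun θ => Real.log (q θ) + V θ with hw
    have hwc : Continuous w :=
      continuous_of_continuous_lift ((hqc.log fun x => (hqpos _).ne').add hV)
    obtain ⟨θ₀, -, hmin⟩ := isCompact_univ.exists_isMinOn
      (⟨cover d Γ 0, mem_univ _⟩ : (univ : Set (FlatQuotient d Γ)).Nonempty) hwc.continuousOn
    have hqw : ∀ θ, q θ = Z * Real.exp (w θ) * π θ := by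
      intro θ
      have hπZ : π θ = Real.exp (-V θ) / Z := rfl
      rw [hπZ]
      simp only [hw, Real.exp_add, Real.exp_log (hqpos θ), Real.exp_neg]
      have := (Real.exp_pos (V θ)).ne'
      field_simp
    refine ⟨Z * Real.exp (w θ₀), by positivity, fun θ => ?_, fun θ => ?_⟩
    · rw [hqw θ]
      have : Real.exp (w θ₀) ≤ Real.exp (w θ) := Real.exp_le_exp.2 (hmin (mem_univ θ))
      have := (hπpos θ).le
      gcongr
    · rw [hqw θ]
      have h1 : Real.exp (w θ) ≤ Real.exp B * Real.exp (w θ₀) := by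
        rw [← Real.exp_add]; exact Real.exp_le_exp.2 (by linarith [hB θ θ₀])
      calc Z * Real.exp (w θ) * π θ ≤ Z * (Real.exp B * Real.exp (w θ₀)) * π θ := by
            have := (hπpos θ).le
            gcongr
        _ = _ := by ring
  -- the log-Sobolev inequality for `exp (h / 2)`, the square root of `g = p / q`
  set f : FlatQuotient d Γ → ℝ := fun η => Real.exp (h η / 2) with hf
  have hfs : ContDiff ℝ 1 (lift f) := (hhs.div_const 2).exp
  have hf2 : ∀ θ, f θ ^ 2 = g θ := by
    intro θ; simp only [hf, hg, ← Real.exp_nat_mul]; congr 1; push_cast; ring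
  have hfg : ∀ θ, gradNorm f θ ^ 2 = g θ * gradNorm h θ ^ 2 / 4 := by
    intro θ
    obtain ⟨x, rfl⟩ := cover_surjective θ
    rw [← hf2]
    change ‖∇ (fun y => Real.exp (lift h y / 2)) x‖ ^ 2 =
      f (cover d Γ x) ^ 2 * ‖∇ (lift h) x‖ ^ 2 / 4
    have hd : HasFDerivAt (fun y => Real.exp (lift h y / 2))
        (Real.exp (lift h x / 2) • ((2 : ℝ)⁻¹ • fderiv ℝ (lift h) x)) x := by
      have := ((hhs.differentiable one_ne_zero x).hasFDerivAt.const_smul (2 : ℝ)⁻¹).exp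
      simpa [div_eq_inv_mul] using this
    rw [norm_gradient, norm_gradient, hd.fderiv, norm_smul, norm_smul,
      Real.norm_of_nonneg (Real.exp_pos _).le]
    simp only [hf, lift, norm_inv, Real.norm_ofNat]
    ring
  have hLSI' := hLSI.integral_sq_mul_log_sq_le_of_contDiff_one hfs
  simp only [hf2, hfg] at hLSI'
  have hden := fun u : FlatQuotient d Γ → ℝ =>
    integral_densityMeasure (F := F) (measurable_of_continuous_lift hπc) (fun θ => (hπpos θ).le) u
  simp only [hden] at hLSI'
  set c := ∫ θ, π θ * g θ ∂(vol F) with hc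
  have hcpos : 0 < c := integral_pos_of_continuous_lift hvol (f := fun θ => π θ * g θ)
    (hπc.mul hgc) fun θ => mul_pos (hπpos θ) (hgpos θ)
  replace hLSI' := hLSI' hcpos
  have hlogg : ∀ θ, Real.log (g θ) = h θ := fun θ => Real.log_exp _
  simp only [hlogg] at hLSI'
  have i1 : Integrable (fun θ => π θ * (g θ * h θ)) (vol F) :=
    integrable_of_continuous_lift (hπc.mul (hgc.mul hhc))
  have i2 : Integrable (fun θ => π θ * g θ) (vol F) :=
    integrable_of_continuous_lift (hπc.mul hgc)
  have i3 : Integrable π (vol F) := integrable_of_continuous_lift hπc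
  have i4 : Integrable (fun θ => π θ * (g θ * gradNorm h θ ^ 2)) (vol F) :=
    integrable_of_continuous_lift (hπc.mul (hgc.mul (hGc.pow 2)))
  have i5 : Integrable (fun θ => p θ * gradNorm h θ ^ 2) (vol F) :=
    integrable_of_continuous_lift (hpc.mul (hGc.pow 2))
  have i6 : Integrable (fun θ => p θ * h θ) (vol F) :=
    integrable_of_continuous_lift (hpc.mul hhc)
  have i7 : Integrable p (vol F) := integrable_of_continuous_lift hpc
  have i8 : Integrable q (vol F) := integrable_of_continuous_lift hqc
  set k : FlatQuotient d Γ → ℝ := fun θ => g θ * (h θ - Real.log c) - g θ + c with hk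
  have hk0 : ∀ θ, 0 ≤ k θ := fun θ => by
    have := mul_log_sub_log_sub_add_nonneg (hgpos θ) hcpos
    rwa [hlogg] at this
  have hkc : Continuous (lift k) :=
    ((hgc.mul (hhc.sub continuous_const)).sub hgc).add continuous_const
  -- replacing the mean of `g` under `q` by any other constant increases the entropy functional
  have s1 : ∫ θ, p θ * h θ ∂(vol F) ≤ ∫ θ, q θ * k θ ∂(vol F) := by
    have e : ∀ θ, q θ * k θ = p θ * h θ - Real.log c * p θ - p θ + c * q θ := by
      intro θ; simp only [hk, ← hqg θ]; ring
    simp only [e]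
    rw [integral_add ((i6.sub' (i7.const_mul _)).sub' i7) (i8.const_mul _),
      integral_sub (i6.sub' (i7.const_mul _)) i7, integral_sub i6 (i7.const_mul _),
      integral_const_mul, integral_const_mul, hp1, hq1]
    linarith [Real.log_le_sub_one_of_pos hcpos]
  have s2 : ∫ θ, q θ * k θ ∂(vol F) ≤ Real.exp B * N * ∫ θ, π θ * k θ ∂(vol F) := by
    rw [← integral_const_mul]
    refine integral_mono (integrable_of_continuous_lift (hqc.mul hkc))
      (integrable_of_continuous_lift (continuous_const.mul (hπc.mul hkc))) fun θ => ?_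
    rw [← mul_assoc]
    exact mul_le_mul_of_nonneg_right (hqN θ) (hk0 θ)
  have s3 : ∫ θ, π θ * k θ ∂(vol F) ≤
      1 / (2 * l) * ∫ θ, π θ * (g θ * gradNorm h θ ^ 2) ∂(vol F) := by
    have e : ∀ θ, π θ * k θ =
        π θ * (g θ * h θ) - Real.log c * (π θ * g θ) - π θ * g θ + c * π θ := by
      intro θ; simp only [hk]; ring
    have e' : ∀ θ, π θ * (g θ * gradNorm h θ ^ 2 / 4) =
      4⁻¹ * (π θ * (g θ * gradNorm h θ ^ 2)) := fun θ => by ring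
    simp only [e]
    rw [integral_add ((i1.sub' (i2.const_mul _)).sub' i2) (i3.const_mul _),
      integral_sub (i1.sub' (i2.const_mul _)) i2, integral_sub i1 (i2.const_mul _),
      integral_const_mul, integral_const_mul, hπ1, ← hc]
    simp only [e'] at hLSI'
    rw [integral_const_mul] at hLSI'
    have e2 : ∀ I : ℝ, 2 / l * (4⁻¹ * I) = 1 / (2 * l) * I := fun I => by field_simp; norm_num
    rw [e2] at hLSI'
    linarith
  have s4 : N * ∫ θ, π θ * (g θ * gradNorm h θ ^ 2) ∂(vol F) ≤
      ∫ θ, p θ * gradNorm h θ ^ 2 ∂(vol F) := by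
    rw [← integral_const_mul]
    refine integral_mono (i4.const_mul N) i5 fun θ => ?_
    simp only [← hqg θ]
    have h1 : 0 ≤ g θ * gradNorm h θ ^ 2 := mul_nonneg (hgpos θ).le (sq_nonneg _)
    have h2 := mul_le_mul_of_nonneg_right (hNq θ) h1
    linarith
  have s5 : ∫ θ, p θ * h θ ∂(vol F) ≤
      Real.exp B * (1 / (2 * l)) * ∫ θ, p θ * gradNorm h θ ^ 2 ∂(vol F) := by
    have t1 := mul_le_mul_of_nonneg_left s3 (by positivity : 0 ≤ Real.exp B * N)
    have t2 := mul_le_mul_of_nonneg_left s4 (by positivity : 0 ≤ Real.exp B * (1 / (2 * l)))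
    linarith
  have t := mul_le_mul_of_nonneg_left s5 (by positivity : 0 ≤ 2 * Real.exp (-B) * l)
  refine t.trans (le_of_eq ?_)
  rw [Real.exp_neg]
  field_simp

end Gibbs

/-! ### Entropy production: the transport and the birth-death terms -/

theorem contDiff_gradient {f : Eucl d → ℝ} (hf : ContDiff ℝ 2 f) : ContDiff ℝ 1 (∇ f) :=
  (InnerProductSpace.toDual ℝ (Eucl d)).symm.contDiff.comp (hf.fderiv_right (by norm_num))

theorem HasFDerivAt.gradient_eq {f : Eucl d → ℝ} {L : Eucl d →L[ℝ] ℝ} {x : Eucl d}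
    (h : HasFDerivAt f L x) : ∇ f x = (InnerProductSpace.toDual ℝ (Eucl d)).symm L := by
  rw [gradient, h.fderiv]

theorem continuous_gradient {f : Eucl d → ℝ} (hf : ContDiff ℝ 1 f) : Continuous (∇ f) :=
  (InnerProductSpace.toDual ℝ (Eucl d)).symm.continuous.comp (hf.continuous_fderiv one_ne_zero)

section FokkerPlanck

variable {p q V V' : FlatQuotient d Γ → ℝ}

/-- The lift of the vector field `∇ p + p ∇ V`, whose divergence drives the Fokker–Planck
equation. -/
def flux (V p : FlatQuotient d Γ → ℝ) (y : Eucl d) : Eucl d :=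
  ∇ (lift p) y + lift p y • ∇ (lift V) y

/-- The Fokker–Planck operator `∇ · (∇ p + p ∇ V)`, as a function on `Θ`. -/
def fokkerPlanck (V p : FlatQuotient d Γ → ℝ) : FlatQuotient d Γ → ℝ :=
  descend (divergence (flux V p))

theorem contDiff_flux (hp : ContDiff ℝ 2 (lift p)) (hV : ContDiff ℝ 2 (lift V)) :
    ContDiff ℝ 1 (flux V p) :=
  (contDiff_gradient hp).add ((hp.of_le (by norm_num)).smul (contDiff_gradient hV))

variable [IsIsometricSMul Γ (Eucl d)]

theorem gradient_lift_smul {f : FlatQuotient d Γ → ℝ} (hf : ContDiff ℝ 1 (lift f)) (γ : Γ)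
    (x : Eucl d) : ∇ (lift f) (γ • x) = linPart d γ (∇ (lift f) x) :=
  gradient_smul (fun γ x => lift_smul f γ x) (hf.differentiable one_ne_zero) γ x

theorem flux_smul (hp : ContDiff ℝ 2 (lift p)) (hV : ContDiff ℝ 2 (lift V)) (γ : Γ) (x : Eucl d) :
    flux V p (γ • x) = linPart d γ (flux V p x) := by
  rw [flux, flux, gradient_lift_smul (hp.of_le (by norm_num)),
    gradient_lift_smul (hV.of_le (by norm_num)), lift_smul, map_add, map_smul]

theorem lift_fokkerPlanck (hp : ContDiff ℝ 2 (lift p)) (hV : ContDiff ℝ 2 (lift V)) :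
    lift (fokkerPlanck V p) = divergence (flux V p) :=
  lift_descend fun γ x => divergence_smul_group
    ((contDiff_flux hp hV).differentiable one_ne_zero) (flux_smul hp hV) γ x

theorem continuous_lift_fokkerPlanck (hp : ContDiff ℝ 2 (lift p)) (hV : ContDiff ℝ 2 (lift V)) :
    Continuous (lift (fokkerPlanck V p)) := by
  rw [lift_fokkerPlanck hp hV]; exact continuous_divergence (contDiff_flux hp hV)

theorem lift_inner_gradient_flux {f : FlatQuotient d Γ → ℝ} (hf : ContDiff ℝ 1 (lift f))
    (hp : ContDiff ℝ 2 (lift p)) (hV : ContDiff ℝ 2 (lift V)) :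
    lift (descend (fun x => inner ℝ (∇ (lift f) x) (flux V p x)) : FlatQuotient d Γ → ℝ) =
      fun x => inner ℝ (∇ (lift f) x) (flux V p x) :=
  lift_descend fun γ x => by
    rw [gradient_lift_smul hf, flux_smul hp hV, LinearIsometryEquiv.inner_map_map]

theorem continuous_lift_inner_gradient_flux {f : FlatQuotient d Γ → ℝ}
    (hf : ContDiff ℝ 1 (lift f)) (hp : ContDiff ℝ 2 (lift p)) (hV : ContDiff ℝ 2 (lift V)) :
    Continuous (lift (descend (fun x => inner ℝ (∇ (lift f) x) (flux V p x)) :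
      FlatQuotient d Γ → ℝ)) := by
  rw [lift_inner_gradient_flux hf hp hV]
  exact (continuous_gradient hf).inner (contDiff_flux hp hV).continuous

variable [ProperlyDiscontinuousSMul Γ (Eucl d)] [CompactSpace (FlatQuotient d Γ)]
  {F : Set (Eucl d)}

/-- The weak form of the Fokker–Planck operator. -/
theorem integral_mul_fokkerPlanck (hF : IsFundamentalDomain Γ F volume)
    {f : FlatQuotient d Γ → ℝ} (hf : ContDiff ℝ 1 (lift f))
    (hp : ContDiff ℝ 2 (lift p)) (hV : ContDiff ℝ 2 (lift V)) :
    ∫ θ, f θ * fokkerPlanck V p θ ∂(vol F) =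
      -∫ θ : FlatQuotient d Γ,
        descend (fun x => inner ℝ (∇ (lift f) x) (flux V p x)) θ ∂(vol F) := by
  have := isFiniteMeasure_vol hF
  have c1 : Continuous (lift fun θ => f θ * fokkerPlanck V p θ) :=
    hf.continuous.mul (continuous_lift_fokkerPlanck hp hV)
  have c2 := continuous_lift_inner_gradient_flux hf hp hV
  rw [eq_neg_iff_add_eq_zero, ← integral_add (integrable_of_continuous_lift c1)
    (integrable_of_continuous_lift c2), integral_vol (measurable_of_continuous_lift (c1.add c2)),
    ← setIntegral_mul_divergence hF hf (fun γ x => lift_smul f γ x) (contDiff_flux hp hV)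
      (flux_smul hp hV)]
  congr 1
  funext x
  have e1 := congrFun (lift_fokkerPlanck hp hV) x
  have e2 := congrFun (lift_inner_gradient_flux hf hp hV) x
  rw [← e1, ← e2]; rfl

theorem integral_fokkerPlanck (hF : IsFundamentalDomain Γ F volume)
    (hp : ContDiff ℝ 2 (lift p)) (hV : ContDiff ℝ 2 (lift V)) :
    ∫ θ, fokkerPlanck V p θ ∂(vol F) = 0 := by
  have h := integral_mul_fokkerPlanck hF (f := fun _ => 1) contDiff_const hp hV
  have e : ∀ x : Eucl d, ∇ (lift fun _ : FlatQuotient d Γ => (1 : ℝ)) x = 0 := by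
    intro x
    change ∇ (fun _ : Eucl d => (1 : ℝ)) x = 0
    simp [gradient]
  simpa [e, descend] using h

/-- Dissipation of relative entropy along two Fokker–Planck flows whose drifts differ by at most
`Δ`: the relative Fisher information absorbs the difference of the drifts, up to a fraction
`c`. -/
theorem integral_transport_le (hF : IsFundamentalDomain Γ F volume)
    (hp : ContDiff ℝ 2 (lift p)) (hq : ContDiff ℝ 2 (lift q))
    (hV : ContDiff ℝ 2 (lift V)) (hV' : ContDiff ℝ 2 (lift V'))
    (hppos : ∀ θ, 0 < p θ) (hqpos : ∀ θ, 0 < q θ) (hp1 : ∫ θ, p θ ∂(vol F) = 1)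
    {Δ c : ℝ} (hΔ : ∀ x, ‖∇ (lift V) x - ∇ (lift V') x‖ ≤ Δ) (hc : 0 < c) :
    ∫ θ, ((Real.log (p θ) - Real.log (q θ)) * fokkerPlanck V p θ
        - p θ / q θ * fokkerPlanck V' q θ) ∂(vol F) ≤
      Δ ^ 2 / (4 * c) - (1 - c) *
        ∫ θ, p θ * gradNorm (fun η => Real.log (p η) - Real.log (q η)) θ ^ 2 ∂(vol F) := by
  have := isFiniteMeasure_vol hF
  have hp' : ContDiff ℝ 1 (lift p) := hp.of_le (by norm_num)
  have hq' : ContDiff ℝ 1 (lift q) := hq.of_le (by norm_num)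
  set h : FlatQuotient d Γ → ℝ := fun η => Real.log (p η) - Real.log (q η) with hh
  have hhs : ContDiff ℝ 1 (lift h) :=
    (hp'.log fun x => (hppos _).ne').sub (hq'.log fun x => (hqpos _).ne')
  have hpq : ContDiff ℝ 1 (lift fun θ => p θ / q θ) := hp'.div hq' fun x => (hqpos _).ne'
  have c1 := continuous_lift_inner_gradient_flux hhs hp hV
  have c2 := continuous_lift_inner_gradient_flux hpq hq hV'
  have c3 : Continuous (lift fun θ => h θ * fokkerPlanck V p θ) :=
    hhs.continuous.mul (continuous_lift_fokkerPlanck hp hV)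
  have c4 : Continuous (lift fun θ => p θ / q θ * fokkerPlanck V' q θ) :=
    hpq.continuous.mul (continuous_lift_fokkerPlanck hq hV')
  have c5 : Continuous (lift fun θ => p θ * gradNorm h θ ^ 2) :=
    hp.continuous.mul ((continuous_lift_gradNorm hhs).pow 2)
  rw [integral_sub (integrable_of_continuous_lift c3) (integrable_of_continuous_lift c4),
    integral_mul_fokkerPlanck hF hhs hp hV, integral_mul_fokkerPlanck hF hpq hq hV',
    sub_neg_eq_add, neg_add_eq_sub, ← integral_sub (integrable_of_continuous_lift c2)
      (integrable_of_continuous_lift c1)]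
  have e : Δ ^ 2 / (4 * c) - (1 - c) * ∫ θ, p θ * gradNorm h θ ^ 2 ∂(vol F) =
      ∫ θ, (Δ ^ 2 / (4 * c) * p θ - (1 - c) * (p θ * gradNorm h θ ^ 2)) ∂(vol F) := by
    rw [integral_sub ((integrable_of_continuous_lift hp.continuous).const_mul _)
      ((integrable_of_continuous_lift c5).const_mul _), integral_const_mul, integral_const_mul,
      hp1, mul_one]
  rw [e]
  refine integral_mono (integrable_of_continuous_lift (c2.sub c1))
    (((integrable_of_continuous_lift hp.continuous).const_mul _).sub
      ((integrable_of_continuous_lift c5).const_mul _)) fun θ => ?_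
  obtain ⟨x, rfl⟩ := cover_surjective θ
  have e1 : descend (fun x => inner ℝ (∇ (lift h) x) (flux V p x)) (cover d Γ x) =
    inner ℝ (∇ (lift h) x) (flux V p x) := congrFun (lift_inner_gradient_flux hhs hp hV) x
  have e2 : descend (fun x => inner ℝ (∇ (lift fun θ => p θ / q θ) x) (flux V' q x))
      (cover d Γ x) = inner ℝ (∇ (lift fun θ => p θ / q θ) x) (flux V' q x) :=
    congrFun (lift_inner_gradient_flux hpq hq hV') x
  simp only [e1, e2]
  change _ ≤ Δ ^ 2 / (4 * c) * lift p x - (1 - c) * (lift p x * ‖∇ (lift h) x‖ ^ 2)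
  set P := lift p x with hP
  set Q := lift q x with hQ
  have hPpos : 0 < P := hppos _
  have hQpos : 0 < Q := hqpos _
  have hdp := (hp'.differentiable one_ne_zero x).hasFDerivAt
  have hdq := (hq'.differentiable one_ne_zero x).hasFDerivAt
  have g1 : ∇ (lift h) x = P⁻¹ • ∇ (lift p) x - Q⁻¹ • ∇ (lift q) x := by
    have : HasFDerivAt (lift h) (P⁻¹ • fderiv ℝ (lift p) x - Q⁻¹ • fderiv ℝ (lift q) x) x :=
      (hdp.log hPpos.ne').sub (hdq.log hQpos.ne')
    rw [this.gradient_eq, map_sub, map_smul, map_smul]; rfl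
  have g2 : ∇ (lift fun θ => p θ / q θ) x = (P / Q) • ∇ (lift h) x := by
    have hexp : (lift fun θ => p θ / q θ) = fun y => Real.exp (lift h y) := by
      funext y
      change p _ / q _ = Real.exp (Real.log (p _) - Real.log (q _))
      rw [Real.exp_sub, Real.exp_log (hppos _), Real.exp_log (hqpos _)]
    have hx : Real.exp (lift h x) = P / Q := (congrFun hexp x).symm
    rw [hexp, (hhs.differentiable one_ne_zero x).hasFDerivAt.exp.gradient_eq, hx, map_smul]; rfl
  set D := ∇ (lift h) x with hD
  have g3 : inner ℝ (∇ (lift fun θ => p θ / q θ) x) (flux V' q x) - inner ℝ D (flux V p x) =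
      -(P * ‖D‖ ^ 2) - P * inner ℝ D (∇ (lift V) x - ∇ (lift V') x) := by
    have hDD : ‖D‖ ^ 2 = P⁻¹ * inner ℝ D (∇ (lift p) x) - Q⁻¹ * inner ℝ D (∇ (lift q) x) := by
      rw [← real_inner_self_eq_norm_sq, ← real_inner_smul_right, ← real_inner_smul_right,
        ← inner_sub_right, ← g1]
    rw [g2, hDD]
    simp only [flux, ← hP, ← hQ, inner_add_right, inner_sub_right, inner_smul_right,
      inner_smul_left, RCLike.conj_to_real]
    field_simp
    ring
  rw [g3]
  have h1 : -inner ℝ D (∇ (lift V) x - ∇ (lift V') x) ≤ ‖D‖ * Δ := by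
    refine (neg_le_abs _).trans ((abs_real_inner_le_norm _ _).trans ?_)
    exact mul_le_mul_of_nonneg_left (hΔ x) (norm_nonneg _)
  have h2 : ‖D‖ * Δ ≤ c * ‖D‖ ^ 2 + Δ ^ 2 / (4 * c) := by
    have : c * ‖D‖ ^ 2 + Δ ^ 2 / (4 * c) - ‖D‖ * Δ = (2 * c * ‖D‖ - Δ) ^ 2 / (4 * c) := by
      field_simp; ring
    have : 0 ≤ (2 * c * ‖D‖ - Δ) ^ 2 / (4 * c) := by positivity
    linarith
  have h3 := mul_le_mul_of_nonneg_left (h1.trans h2) hPpos.le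
  linarith

end FokkerPlanck

section BirthDeath

variable [CompactSpace (FlatQuotient d Γ)] {μ : Measure (FlatQuotient d Γ)} [IsFiniteMeasure μ]

theorem sub_integral_mul_le {p u : FlatQuotient d Γ → ℝ} (hp : Continuous (lift p))
    (hu : Continuous (lift u)) (hpos : ∀ θ, 0 < p θ) (hp1 : ∫ θ, p θ ∂μ = 1) {r : ℝ}
    {θ : FlatQuotient d Γ} (hr : ∀ η, u θ - u η ≤ r) : u θ - ∫ η, p η * u η ∂μ ≤ r := by
  have ip : Integrable p μ := integrable_of_continuous_lift hp
  have iu : Integrable (fun η => p η * u η) μ := integrable_of_continuous_lift (hp.mul hu)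
  have h : ∫ η, (u θ - r) * p η ∂μ ≤ ∫ η, p η * u η ∂μ :=
    integral_mono (ip.const_mul _) iu fun η => by
      have := mul_le_mul_of_nonneg_right (by linarith [hr η] : u θ - r ≤ u η) (hpos η).le
      linarith
  rw [integral_const_mul, hp1] at h
  linarith

theorem exists_abs_sub_le_half {u : FlatQuotient d Γ → ℝ} (hu : Continuous (lift u)) {r : ℝ}
    (hr : ∀ θ η, u θ - u η ≤ r) : ∃ k, ∀ θ, |u θ - k| ≤ r / 2 := by
  have hne : (univ : Set (FlatQuotient d Γ)).Nonempty := ⟨cover d Γ 0, mem_univ _⟩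
  have hc := (continuous_of_continuous_lift hu).continuousOn (s := univ)
  obtain ⟨a, -, ha⟩ := isCompact_univ.exists_isMinOn hne hc
  obtain ⟨b, -, hb⟩ := isCompact_univ.exists_isMaxOn hne hc
  refine ⟨(u a + u b) / 2, fun θ => abs_le.2 ?_⟩
  have h1 : u a ≤ u θ := ha (mem_univ θ)
  have h2 : u θ ≤ u b := hb (mem_univ θ)
  have h3 := hr b a
  constructor <;> linarith

/-- The mean absolute deviation is at most half the oscillation. -/
theorem integral_abs_sub_mean_le {p u : FlatQuotient d Γ → ℝ} (hp : Continuous (lift p))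
    (hu : Continuous (lift u)) (hpos : ∀ θ, 0 < p θ) (hp1 : ∫ θ, p θ ∂μ = 1) {r : ℝ}
    (hr : ∀ θ η, u θ - u η ≤ r) :
    ∫ θ, p θ * |u θ - ∫ η, p η * u η ∂μ| ∂μ ≤ r / 2 := by
  set a := ∫ η, p η * u η ∂μ with ha
  have hr0 : 0 ≤ r := by simpa using hr (cover d Γ 0) (cover d Γ 0)
  have ip : Integrable p μ := integrable_of_continuous_lift hp
  have iu : Integrable (fun η => p η * u η) μ := integrable_of_continuous_lift (hp.mul hu)
  have cabs : Continuous (lift fun θ => p θ * |u θ - a|) := hp.mul (hu.sub continuous_const).abs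
  rcases hr0.eq_or_lt with h0 | hrpos
  · have hua : ∀ θ, u θ - a = 0 := by
      intro θ
      have hconst : ∀ η, u η = u θ := fun η => by linarith [hr θ η, hr η θ]
      rw [ha]; simp only [hconst]
      rw [integral_mul_const, hp1]; ring
    simp [hua, ← h0]
  · obtain ⟨k, hk⟩ := exists_abs_sub_le_half hu hr
    -- `|x| ≤ x ^ 2 / r + r / 4`, and the variance is at most the mean square distance to `k`
    have hpt : ∀ θ, p θ * |u θ - a| ≤
        (r / 2 + (a ^ 2 - k ^ 2) / r) * p θ + (2 * (k - a) / r) * (p θ * u θ) := by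
      intro θ
      have h1 : |u θ - a| ≤ (u θ - a) ^ 2 / r + r / 4 := by
        have e : (u θ - a) ^ 2 / r + r / 4 - |u θ - a| = (|u θ - a| - r / 2) ^ 2 / r := by
          rw [← sq_abs (u θ - a)]; field_simp; ring
        have : 0 ≤ (|u θ - a| - r / 2) ^ 2 / r := by positivity
        linarith
      have h2 : (u θ - k) ^ 2 / r ≤ r / 4 := by
        rw [div_le_iff₀ hrpos]
        have := sq_le_sq' (abs_le.1 (hk θ)).1 (abs_le.1 (hk θ)).2
        nlinarith
      have h3 : (u θ - a) ^ 2 / r = (u θ - k) ^ 2 / r + (a ^ 2 - k ^ 2) / r +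
          2 * (k - a) / r * u θ := by field_simp; ring
      have := mul_le_mul_of_nonneg_left (by linarith : |u θ - a| ≤ r / 2 + (a ^ 2 - k ^ 2) / r +
          2 * (k - a) / r * u θ) (hpos θ).le
      linarith
    refine (integral_mono (integrable_of_continuous_lift cabs)
      ((ip.const_mul _).fun_add (iu.const_mul _)) hpt).trans ?_
    rw [integral_add (ip.const_mul _) (iu.const_mul _), integral_const_mul, integral_const_mul,
      hp1, ← ha]
    have : (r / 2 + (a ^ 2 - k ^ 2) / r) * 1 + 2 * (k - a) / r * a = r / 2 - (a - k) ^ 2 / r := by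
      field_simp; ring
    rw [this]
    have : 0 ≤ (a - k) ^ 2 / r := by positivity
    linarith

/-- The contribution of the birth-death terms to the growth of relative entropy. Here `u` and
`u'` stand for the log-densities relative to the two targets, and `w` for the log-ratio of
the targets. -/
theorem integral_birthDeath_le {p q u u' w : FlatQuotient d Γ → ℝ} (hp : Continuous (lift p))
    (hq : Continuous (lift q)) (hu : Continuous (lift u)) (hu' : Continuous (lift u'))
    (hw : Continuous (lift w))
    (hppos : ∀ θ, 0 < p θ) (hqpos : ∀ θ, 0 < q θ)
    (hp1 : ∫ θ, p θ ∂μ = 1) (hq1 : ∫ θ, q θ ∂μ = 1) {r S : ℝ}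
    (hr : ∀ θ η, u θ - u η ≤ r) (hr' : ∀ θ η, u' θ - u' η ≤ r) (hS : ∀ θ, |w θ| ≤ S) :
    ∫ θ, p θ * (-(u θ - ∫ η, p η * u η ∂μ) * (u θ - u' θ + w θ)
        - (u θ - ∫ η, p η * u η ∂μ) + (u' θ - ∫ η, q η * u' η ∂μ)) ∂μ ≤
      r * (S / 2 + 2) + r ^ 2 / 16 := by
  have hr0 : 0 ≤ r := by simpa using hr (cover d Γ 0) (cover d Γ 0)
  have hS0 : 0 ≤ S := (abs_nonneg _).trans (hS (cover d Γ 0))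
  have hI := integral_abs_sub_mean_le hp hu hppos hp1 hr
  set a := ∫ η, p η * u η ∂μ with ha
  set b := ∫ η, q η * u' η ∂μ with hb
  obtain ⟨k, hk⟩ := exists_abs_sub_le_half hu' hr'
  have ip : Integrable p μ := integrable_of_continuous_lift hp
  have iu : Integrable (fun η => p η * u η) μ := integrable_of_continuous_lift (hp.mul hu)
  have iabs : Integrable (fun θ => p θ * |u θ - a|) μ :=
    integrable_of_continuous_lift (hp.mul (hu.sub continuous_const).abs)
  have hpt : ∀ θ, p θ * (-(u θ - a) * (u θ - u' θ + w θ) - (u θ - a) + (u' θ - b)) ≤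
      (r ^ 2 / 16 + r) * p θ + S * (p θ * |u θ - a|) + (k - a - 1) * (p θ * u θ - a * p θ) := by
    intro θ
    have h1 : u' θ - b ≤ r := sub_integral_mul_le hq hu' hqpos hq1 (hr' θ)
    have h2 : -((u θ - a) * w θ) ≤ S * |u θ - a| := by
      refine (neg_le_abs _).trans ?_
      rw [abs_mul, mul_comm]
      exact mul_le_mul_of_nonneg_right (hS θ) (abs_nonneg _)
    have h3 : -(u θ - a) ^ 2 + (u θ - a) * (u' θ - k) ≤ r ^ 2 / 16 := by
      have := sq_le_sq' (abs_le.1 (hk θ)).1 (abs_le.1 (hk θ)).2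
      nlinarith [sq_nonneg (2 * (u θ - a) - (u' θ - k))]
    have h4 : -(u θ - a) * (u θ - u' θ + w θ) - (u θ - a) + (u' θ - b) ≤
        r ^ 2 / 16 + r + S * |u θ - a| + (k - a - 1) * (u θ - a) := by nlinarith
    have := mul_le_mul_of_nonneg_left h4 (hppos θ).le
    linarith
  have c0 : Continuous (lift fun θ =>
      p θ * (-(u θ - a) * (u θ - u' θ + w θ) - (u θ - a) + (u' θ - b))) :=
    hp.mul ((((hu.sub continuous_const).neg.mul ((hu.sub hu').add hw)).sub
      (hu.sub continuous_const)).add (hu'.sub continuous_const))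
  refine (integral_mono (integrable_of_continuous_lift c0)
    (((ip.const_mul _).fun_add (iabs.const_mul _)).fun_add
      ((iu.sub' (ip.const_mul _)).const_mul _))
    hpt).trans ?_
  rw [integral_add ((ip.const_mul _).fun_add (iabs.const_mul _))
      ((iu.sub' (ip.const_mul _)).const_mul _),
    integral_add (ip.const_mul _) (iabs.const_mul _), integral_const_mul, integral_const_mul,
    integral_const_mul, integral_sub iu (ip.const_mul _), integral_const_mul, hp1, ← ha]
  have := mul_le_mul_of_nonneg_left hI hS0
  linarith

end BirthDeath

/-! ### The maximum principle -/

theorem deriv_deriv_nonpos_of_isLocalMax {f : ℝ → ℝ} {a : ℝ} (h : IsLocalMax f a)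
    (hc : ContinuousAt f a) : deriv (deriv f) a ≤ 0 := by
  by_contra! hpos
  have hmin := isLocalMin_of_deriv_deriv_pos hpos h.deriv_eq_zero hc
  have hconst : f =ᶠ[nhds a] fun _ => f a := by
    filter_upwards [h, hmin] with x h1 h2 using le_antisymm h1 h2
  have h2 : deriv f =ᶠ[nhds a] fun _ => 0 := by
    filter_upwards [hconst.deriv] with x hx
    rw [hx]; simp
  rw [h2.deriv_eq] at hpos
  simp at hpos

theorem gradient_eq_zero_of_forall_le {f : Eucl d → ℝ} {x : Eucl d} (h : ∀ y, f y ≤ f x) :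
    ∇ f x = 0 := by
  have : IsLocalMax f x := Filter.Eventually.of_forall h
  rw [gradient, this.fderiv_eq_zero, map_zero]

/-- The Laplacian is nonpositive at a maximum. -/
theorem divergence_gradient_nonpos_of_forall_le {f : Eucl d → ℝ} (hf : ContDiff ℝ 2 f)
    {x : Eucl d} (h : ∀ y, f y ≤ f x) : divergence (∇ f) x ≤ 0 := by
  refine Finset.sum_nonpos fun i _ => ?_
  set e : Eucl d := EuclideanSpace.single i 1 with he
  have hline : ∀ s : ℝ, HasDerivAt (fun s : ℝ => x + s • e) e s := fun s => by
    simpa using ((hasDerivAt_id s).smul_const e).const_add x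
  have h1 : deriv (fun s : ℝ => f (x + s • e)) = fun s => (∇ f (x + s • e)) i := by
    funext s
    have := ((hf.differentiable two_ne_zero (x + s • e)).hasFDerivAt.comp_hasDerivAt s
      (hline s)).deriv
    refine Eq.trans this ?_
    have hi : inner ℝ (∇ f (x + s • e)) e = (∇ f (x + s • e)) i := by
      rw [he, EuclideanSpace.inner_single_right]; simp
    rw [← hi, gradient, InnerProductSpace.toDual_symm_apply]
  have h2 : deriv (fun s : ℝ => (∇ f (x + s • e)) i) 0 = (fderiv ℝ (∇ f) x e) i := by
    have hg := ((contDiff_gradient hf).differentiable one_ne_zero (x + (0 : ℝ) • e)).hasFDerivAt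
    have := ((EuclideanSpace.proj i : Eucl d →L[ℝ] ℝ).hasFDerivAt.comp_hasDerivAt (0 : ℝ)
      (hg.comp_hasDerivAt (0 : ℝ) (hline 0))).deriv
    refine Eq.trans this ?_
    simp
  rw [← h2, ← h1]
  refine deriv_deriv_nonpos_of_isLocalMax (Filter.Eventually.of_forall fun s => ?_) ?_
  · simpa using h (x + s • e)
  · exact (hf.continuous.comp (by fun_prop)).continuousAt

theorem divergence_neg (X : Eucl d → Eucl d) (x : Eucl d) :
    divergence (fun y => -X y) x = -divergence X x := by
  simp [divergence, fderiv_fun_neg]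

theorem gradient_neg (f : Eucl d → ℝ) : ∇ (fun y => -f y) = fun y => -∇ f y := by
  funext y
  simp [gradient, fderiv_fun_neg]

theorem gradient_eq_zero_of_forall_ge {f : Eucl d → ℝ} {x : Eucl d} (h : ∀ y, f x ≤ f y) :
    ∇ f x = 0 := by
  have : IsLocalMin f x := Filter.Eventually.of_forall h
  rw [gradient, this.fderiv_eq_zero, map_zero]

theorem divergence_gradient_nonneg_of_forall_ge {f : Eucl d → ℝ} (hf : ContDiff ℝ 2 f)
    {x : Eucl d} (h : ∀ y, f x ≤ f y) : 0 ≤ divergence (∇ f) x := by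
  have := divergence_gradient_nonpos_of_forall_le hf.neg (x := x) fun y => neg_le_neg (h y)
  rw [gradient_neg, divergence_neg] at this
  linarith

/-- At a critical point of `log p + V`, the field `∇ p + p ∇ V = p ∇ (log p + V)` has divergence
`p Δ (log p + V)`. -/
theorem divergence_flux_of_gradient_eq_zero {p V : FlatQuotient d Γ → ℝ}
    (hp : ContDiff ℝ 2 (lift p)) (hV : ContDiff ℝ 2 (lift V)) (hpos : ∀ θ, 0 < p θ) {x : Eucl d}
    (hx : ∇ (lift fun θ => Real.log (p θ) + V θ) x = 0) :
    divergence (flux V p) x =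
      lift p x * divergence (∇ (lift fun θ => Real.log (p θ) + V θ)) x := by
  have hU : ContDiff ℝ 2 (lift fun θ => Real.log (p θ) + V θ) :=
    (hp.log fun x => (hpos _).ne').add hV
  have hflux : flux V p = fun y => lift p y • ∇ (lift fun θ => Real.log (p θ) + V θ) y := by
    funext y
    have hd : HasFDerivAt (lift fun θ => Real.log (p θ) + V θ)
        ((lift p y)⁻¹ • fderiv ℝ (lift p) y + fderiv ℝ (lift V) y) y :=
      ((hp.differentiable two_ne_zero y).hasFDerivAt.log (hpos _).ne').add
        (hV.differentiable two_ne_zero y).hasFDerivAt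
    have hne : lift p y ≠ 0 := (hpos _).ne'
    rw [hd.gradient_eq, map_add, map_smul, smul_add, smul_smul, mul_inv_cancel₀ hne, one_smul]
    rfl
  rw [hflux, divergence_smul (hp.differentiable two_ne_zero x)
    ((contDiff_gradient hU).differentiable one_ne_zero x), hx, inner_zero_right, add_zero]

theorem IsSHKSolution.hasDerivWithinAt {F : Set (Eucl d)} {T : ℝ} {V : FlatQuotient d Γ → ℝ}
    {ρ : ℝ → FlatQuotient d Γ → ℝ} (h : IsSHKSolution F T V ρ) {t : ℝ} (ht : t ∈ Icc 0 T)
    (θ : FlatQuotient d Γ) :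
    HasDerivWithinAt (fun s => ρ s θ) (timeDeriv T ρ t θ) (Icc 0 T) t :=
  (h.isC12.differentiable_time t ht θ).hasDerivWithinAt

/-- The **maximum principle**: along the flow, the oscillation of `log (ρ / π)` decays at rate `1`.
The diffusion cannot increase it, and the birth-death term contracts it. -/
theorem IsSHKSolution.log_add_sub_le [IsIsometricSMul Γ (Eucl d)]
    [CompactSpace (FlatQuotient d Γ)] {F : Set (Eucl d)}
    [IsFiniteMeasure (vol F : Measure (FlatQuotient d Γ))]
    (hvol : (vol F : Measure (FlatQuotient d Γ)) ≠ 0) {T : ℝ} {V : FlatQuotient d Γ → ℝ}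
    (hV : ContDiff ℝ 2 (lift V)) {ρ : ℝ → FlatQuotient d Γ → ℝ} (hρ : IsSHKSolution F T V ρ)
    {B : ℝ} (hB : ∀ θ η, (Real.log (ρ 0 θ) + V θ) - (Real.log (ρ 0 η) + V η) ≤ B)
    {t : ℝ} (ht : t ∈ Icc 0 T) (θ η : FlatQuotient d Γ) :
    (Real.log (ρ t θ) + V θ) - (Real.log (ρ t η) + V η) ≤ B * Real.exp (-t) := by
  obtain ⟨K, hK, hsurj⟩ := exists_isCompact_surjOn (d := d) (Γ := Γ)
  set U : ℝ → FlatQuotient d Γ → ℝ := fun t θ => Real.log (ρ t θ) + V θ with hU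
  have hUc : ContinuousOn (fun p : ℝ × Eucl d => lift (U p.1) p.2) (Icc 0 T ×ˢ univ) :=
    (hρ.isC12.continuous.log fun p hp => (hρ.pos p.1 hp.1 _).ne').add
      (hV.continuous.comp continuous_snd).continuousOn
  -- it suffices to bound `exp t * (U t θ - U t η) - δ * t` for every `δ > 0`
  have key : ∀ δ : ℝ, 0 < δ → Real.exp t * (U t θ - U t η) - δ * t ≤ B := by
    intro δ hδ
    set W : ℝ × Eucl d × Eucl d → ℝ := fun z =>
      Real.exp z.1 * (lift (U z.1) z.2.1 - lift (U z.1) z.2.2) - δ * z.1 with hW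
    have hWc : ContinuousOn W (Icc 0 T ×ˢ (K ×ˢ K)) := by
      have h1 : ContinuousOn (fun z : ℝ × Eucl d × Eucl d => lift (U z.1) z.2.1)
          (Icc 0 T ×ˢ (K ×ˢ K)) :=
        hUc.comp (f := fun z : ℝ × Eucl d × Eucl d => (z.1, z.2.1)) (by fun_prop)
          fun z hz => ⟨hz.1, mem_univ _⟩
      have h2 : ContinuousOn (fun z : ℝ × Eucl d × Eucl d => lift (U z.1) z.2.2)
          (Icc 0 T ×ˢ (K ×ˢ K)) :=
        hUc.comp (f := fun z : ℝ × Eucl d × Eucl d => (z.1, z.2.2)) (by fun_prop)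
          fun z hz => ⟨hz.1, mem_univ _⟩
      exact ((Real.continuous_exp.comp continuous_fst).continuousOn.mul (h1.sub h2)).sub
        (continuous_const.mul continuous_fst).continuousOn
    obtain ⟨γ₀, hγ₀⟩ := hsurj 0
    obtain ⟨⟨t₀, x₀, y₀⟩, ⟨ht₀, hx₀, hy₀⟩, hmax⟩ :=
      (isCompact_Icc.prod (hK.prod hK)).exists_isMaxOn
        ⟨(t, γ₀ • (0 : Eucl d), γ₀ • (0 : Eucl d)), ht, hγ₀, hγ₀⟩ hWc
    have hmax' : ∀ s ∈ Icc 0 T, ∀ x y : Eucl d, W (s, x, y) ≤ W (t₀, x₀, y₀) := by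
      intro s hs x y
      obtain ⟨γ, hγ⟩ := hsurj x
      obtain ⟨γ', hγ'⟩ := hsurj y
      have := hmax (show (s, γ • x, γ' • y) ∈ Icc 0 T ×ˢ (K ×ˢ K) from ⟨hs, hγ, hγ'⟩)
      simpa only [hW, lift_smul, mem_ofPred_eq] using this
    replace ht₀ : t₀ ∈ Icc 0 T := ht₀
    have hexp := Real.exp_pos t₀
    have hxmax : ∀ y, lift (U t₀) y ≤ lift (U t₀) x₀ := by
      intro y
      have := hmax' t₀ ht₀ y y₀
      simp only [hW] at this
      nlinarith
    have hymin : ∀ y, lift (U t₀) y₀ ≤ lift (U t₀) y := by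
      intro y
      have := hmax' t₀ ht₀ x₀ y
      simp only [hW] at this
      nlinarith
    have hfin : W (t₀, x₀, y₀) ≤ B := by
      rcases ht₀.1.eq_or_lt with h0 | hpos
      · have h := hB (cover d Γ x₀) (cover d Γ y₀)
        simp only [hW, hU, lift]
        rw [← h0, Real.exp_zero, one_mul, mul_zero, sub_zero]
        exact h
      · -- at a positive time the time derivative at the maximum is both nonnegative and negative
        exfalso
        have hp2 := hρ.isC12.contDiff_space t₀ ht₀
        have hppos := hρ.pos t₀ ht₀
        have hU2 : ContDiff ℝ 2 (lift (U t₀)) := (hp2.log fun x => (hppos _).ne').add hV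
        have hder : ∀ θ, HasDerivWithinAt (fun s => U s θ)
            (timeDeriv T ρ t₀ θ / ρ t₀ θ) (Icc 0 T) t₀ := fun θ =>
          ((hρ.hasDerivWithinAt ht₀ θ).log (hppos θ).ne').add_const (V θ)
        have hrate : ∀ x, ∇ (lift (U t₀)) x = 0 →
            timeDeriv T ρ t₀ (cover d Γ x) / ρ t₀ (cover d Γ x) =
              divergence (∇ (lift (U t₀))) x - birthDeathRate F V (ρ t₀) (cover d Γ x) := by
          intro x hx
          have hdiv := divergence_flux_of_gradient_eq_zero hp2 hV hppos hx
          have heq : timeDeriv T ρ t₀ (cover d Γ x) = divergence (flux V (ρ t₀)) x -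
            birthDeathRate F V (ρ t₀) (cover d Γ x) * ρ t₀ (cover d Γ x) := hρ.equation t₀ ht₀ x
          rw [heq, hdiv, div_eq_iff (hppos _).ne']
          simp only [lift]
          ring
        have hWder : HasDerivWithinAt (fun s => W (s, x₀, y₀))
            (Real.exp t₀ * (lift (U t₀) x₀ - lift (U t₀) y₀) + Real.exp t₀ *
              (timeDeriv T ρ t₀ (cover d Γ x₀) / ρ t₀ (cover d Γ x₀) -
                timeDeriv T ρ t₀ (cover d Γ y₀) / ρ t₀ (cover d Γ y₀)) - δ * 1) (Icc 0 T) t₀ :=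
          ((Real.hasDerivAt_exp t₀).hasDerivWithinAt.fun_mul ((hder (cover d Γ x₀)).fun_sub
            (hder (cover d Γ y₀)))).fun_sub ((hasDerivWithinAt_id t₀ _).const_mul δ)
        have hloc : IsLocalMaxOn (fun s => W (s, x₀, y₀)) (Icc 0 T) t₀ := by
          refine Filter.eventually_of_mem self_mem_nhdsWithin fun s hs => hmax' s hs x₀ y₀
        have hcone : (0 : ℝ) - t₀ ∈ posTangentConeAt (Icc 0 T) t₀ :=
          sub_mem_posTangentConeAt_of_segment_subset
            ((convex_Icc 0 T).segment_subset ht₀ ⟨le_rfl, ht₀.1.trans ht₀.2⟩)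
        have hsign := hloc.hasFDerivWithinAt_nonpos hWder.hasFDerivWithinAt hcone
        rw [hrate x₀ (gradient_eq_zero_of_forall_le hxmax),
          hrate y₀ (gradient_eq_zero_of_forall_ge hymin)] at hsign
        have hα : birthDeathRate F V (ρ t₀) (cover d Γ x₀) -
            birthDeathRate F V (ρ t₀) (cover d Γ y₀) = lift (U t₀) x₀ - lift (U t₀) y₀ := by
          simp only [birthDeathRate, log_gibbs hvol hV.continuous, hU, lift]
          ring
        have hx2 := divergence_gradient_nonpos_of_forall_le hU2 hxmax
        have hy2 := divergence_gradient_nonneg_of_forall_ge hU2 hymin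
        simp only [ContinuousLinearMap.toSpanSingleton_apply, smul_eq_mul] at hsign
        have hneg : Real.exp t₀ * (divergence (∇ (lift (U t₀))) x₀ -
            divergence (∇ (lift (U t₀))) y₀) ≤ 0 :=
          mul_nonpos_of_nonneg_of_nonpos hexp.le (by linarith)
        rw [← hα] at hsign
        nlinarith
    obtain ⟨x, rfl⟩ := cover_surjective θ
    obtain ⟨y, rfl⟩ := cover_surjective η
    exact (hmax' t ht x y).trans hfin
  have hlim : Real.exp t * (U t θ - U t η) ≤ B := by
    refine le_of_forall_pos_le_add fun δ hδ => ?_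
    have ht1 : 0 < t + 1 := by linarith [ht.1]
    have h1 := key (δ / (t + 1)) (by positivity)
    have h2 : δ / (t + 1) * t ≤ δ := by
      rw [div_mul_eq_mul_div, div_le_iff₀ ht1]; nlinarith
    linarith
  have h3 := mul_le_mul_of_nonneg_right hlim (Real.exp_pos (-t)).le
  have h4 : Real.exp t * Real.exp (-t) = 1 := by rw [← Real.exp_add]; simp
  calc U t θ - U t η = Real.exp t * (U t θ - U t η) * Real.exp (-t) := by
        linear_combination (-(U t θ - U t η)) * h4
    _ ≤ _ := h3

/-! ### Time evolution of mass and relative entropy -/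

section TimeDerivative

theorem continuous_lift_of_continuousOn_prod {T : ℝ} {w : ℝ → FlatQuotient d Γ → ℝ}
    (hw : ContinuousOn (fun p : ℝ × Eucl d => lift (w p.1) p.2) (Icc 0 T ×ˢ univ)) {t : ℝ}
    (ht : t ∈ Icc 0 T) : Continuous (lift (w t)) := by
  rw [← continuousOn_univ]
  exact hw.comp (f := fun x : Eucl d => (t, x)) (by fun_prop) fun x _ => ⟨ht, mem_univ _⟩

variable [IsIsometricSMul Γ (Eucl d)] [CompactSpace (FlatQuotient d Γ)]
  {μ : Measure (FlatQuotient d Γ)} [IsFiniteMeasure μ] {T : ℝ} {w w' : ℝ → FlatQuotient d Γ → ℝ}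

theorem continuousOn_integral_of_continuousOn_prod
    (hw : ContinuousOn (fun p : ℝ × Eucl d => lift (w p.1) p.2) (Icc 0 T ×ˢ univ)) :
    ContinuousOn (fun t => ∫ θ, w t θ ∂μ) (Icc 0 T) := by
  obtain ⟨C, hC⟩ := exists_bound_of_continuousOn_prod hw
  refine continuousOn_of_dominated (bound := fun _ => C) (fun t ht => ?_)
    (fun t ht => Filter.Eventually.of_forall fun θ => hC t ht θ) (integrable_const C)
    (Filter.Eventually.of_forall fun θ => ?_)
  · exact (measurable_of_continuous_lift (continuous_lift_of_continuousOn_prod hw ht)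
      ).aestronglyMeasurable
  · obtain ⟨x, rfl⟩ := cover_surjective θ
    exact hw.comp (f := fun t : ℝ => (t, x)) (by fun_prop) fun t ht => ⟨ht, mem_univ _⟩

theorem hasDerivAt_integral_of_continuousOn_prod
    (hw : ContinuousOn (fun p : ℝ × Eucl d => lift (w p.1) p.2) (Icc 0 T ×ˢ univ))
    (hw' : ContinuousOn (fun p : ℝ × Eucl d => lift (w' p.1) p.2) (Icc 0 T ×ˢ univ))
    (hder : ∀ t ∈ Ioo 0 T, ∀ θ, HasDerivAt (fun s => w s θ) (w' t θ) t) {t : ℝ}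
    (ht : t ∈ Ioo 0 T) : HasDerivAt (fun t => ∫ θ, w t θ ∂μ) (∫ θ, w' t θ ∂μ) t := by
  obtain ⟨C, hC⟩ := exists_bound_of_continuousOn_prod hw'
  have hnhds : Ioo 0 T ∈ nhds t := Ioo_mem_nhds ht.1 ht.2
  have hmeas : ∀ {v : ℝ → FlatQuotient d Γ → ℝ}, ContinuousOn
      (fun p : ℝ × Eucl d => lift (v p.1) p.2) (Icc 0 T ×ˢ univ) → ∀ s ∈ Icc 0 T,
      AEStronglyMeasurable (v s) μ := fun hv s hs =>
    (measurable_of_continuous_lift (continuous_lift_of_continuousOn_prod hv hs)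
      ).aestronglyMeasurable
  exact (hasDerivAt_integral_of_dominated_loc_of_deriv_le (bound := fun _ => C) hnhds
    (Filter.mem_of_superset hnhds fun s hs => hmeas hw s (Ioo_subset_Icc_self hs))
    (integrable_of_continuous_lift
      (continuous_lift_of_continuousOn_prod hw (Ioo_subset_Icc_self ht)))
    (hmeas hw' t (Ioo_subset_Icc_self ht))
    (Filter.Eventually.of_forall fun θ s hs => hC s (Ioo_subset_Icc_self hs) θ)
    (integrable_const C) (Filter.Eventually.of_forall fun θ s hs => hder s hs θ)).2

end TimeDerivative

/-- A one-sided Grönwall inequality on a compact interval, which needs the derivative only in the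
interior. -/
theorem nonpos_of_deriv_le_neg_mul {T κ : ℝ} {y y' : ℝ → ℝ} (hc : ContinuousOn y (Icc 0 T))
    (hy : ∀ t ∈ Ioo 0 T, HasDerivAt y (y' t) t) (hle : ∀ t ∈ Ioo 0 T, y' t ≤ -κ * y t)
    (h0 : y 0 ≤ 0) {t : ℝ} (ht : t ∈ Icc 0 T) : y t ≤ 0 := by
  have hexp : ∀ t, HasDerivAt (fun s => Real.exp (κ * s)) (Real.exp (κ * t) * κ) t := fun t => by
    simpa using ((hasDerivAt_id t).const_mul κ).exp
  have hder : ∀ t ∈ Ioo 0 T, HasDerivAt (fun s => Real.exp (κ * s) * y s)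
      (Real.exp (κ * t) * κ * y t + Real.exp (κ * t) * y' t) t := fun t ht =>
    (hexp t).fun_mul (hy t ht)
  have hanti : AntitoneOn (fun s => Real.exp (κ * s) * y s) (Icc 0 T) := by
    refine antitoneOn_of_deriv_nonpos (convex_Icc 0 T)
      ((Continuous.continuousOn (by fun_prop)).mul hc) ?_ ?_
    · rw [interior_Icc]
      exact fun t ht => (hder t ht).differentiableAt.differentiableWithinAt
    · rw [interior_Icc]
      intro t ht
      rw [(hder t ht).deriv]
      have := mul_le_mul_of_nonneg_left (hle t ht) (Real.exp_pos (κ * t)).le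
      linarith
  have h := hanti ⟨le_rfl, ht.1.trans ht.2⟩ ht ht.1
  simp only [mul_zero, Real.exp_zero, one_mul] at h
  have hp := Real.exp_pos (κ * t)
  by_contra! hpos
  have := mul_pos hp hpos
  linarith

theorem klBoundAux_zero (A₁ A₂ A₃ κ : ℝ) : klBoundAux A₁ A₂ A₃ κ 0 = 0 := by
  unfold klBoundAux
  split_ifs <;> simp

/-- The explicit bound solves the linear equation `y' = A₁ + A₂ e⁻ᵗ + A₃ e⁻²ᵗ - κ y`; the
resonant values `κ = 1, 2` have their own formulas. -/
theorem hasDerivAt_klBoundAux (A₁ A₂ A₃ : ℝ) {κ : ℝ} (hκ : κ ≠ 0) (t : ℝ) :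
    HasDerivAt (klBoundAux A₁ A₂ A₃ κ)
      (A₁ + A₂ * Real.exp (-t) + A₃ * Real.exp (-2 * t) - κ * klBoundAux A₁ A₂ A₃ κ t) t := by
  have e : ∀ a : ℝ, HasDerivAt (fun s => Real.exp (a * s)) (a * Real.exp (a * t)) t := fun a => by
    simpa [mul_comm] using ((hasDerivAt_id t).const_mul a).exp
  have e1 : HasDerivAt (fun s => Real.exp (-s)) (-Real.exp (-t)) t := by
    simpa using (hasDerivAt_id t).fun_neg.exp
  have b1 := ((((e (-κ)).const_sub 1).div_const κ).const_mul A₁)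
  have b2 := (((e1.fun_sub (e (-κ))).div_const (κ - 1)).const_mul A₂)
  have b3 := (((e (-2)).fun_sub (e (-κ))).div_const (κ - 2)).const_mul A₃
  have b2' := ((hasDerivAt_id t).fun_mul e1).const_mul A₂
  have b3' := ((hasDerivAt_id t).fun_mul (e (-2))).const_mul A₃
  by_cases h1 : κ = 1
  · have hfun : klBoundAux A₁ A₂ A₃ κ = fun t => A₁ * ((1 - Real.exp (-κ * t)) / κ) +
        A₂ * (t * Real.exp (-t)) +
        A₃ * ((Real.exp (-2 * t) - Real.exp (-κ * t)) / (κ - 2)) := by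
      funext s; simp [klBoundAux, h1]
    rw [hfun]
    refine ((b1.fun_add b2').fun_add b3).congr_deriv ?_
    subst h1
    simp only [id]
    norm_num
    ring
  · have hκ1 : κ - 1 ≠ 0 := sub_ne_zero.2 h1
    by_cases h2 : κ = 2
    · have hfun : klBoundAux A₁ A₂ A₃ κ = fun t => A₁ * ((1 - Real.exp (-κ * t)) / κ) +
          A₂ * ((Real.exp (-t) - Real.exp (-κ * t)) / (κ - 1)) +
          A₃ * (t * Real.exp (-2 * t)) := by
        funext s; simp [klBoundAux, h2]
      rw [hfun]
      refine ((b1.fun_add b2).fun_add b3').congr_deriv ?_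
      subst h2
      simp only [id]
      norm_num
      ring
    · have hκ2 : κ - 2 ≠ 0 := sub_ne_zero.2 h2
      have hfun : klBoundAux A₁ A₂ A₃ κ = fun t => A₁ * ((1 - Real.exp (-κ * t)) / κ) +
          A₂ * ((Real.exp (-t) - Real.exp (-κ * t)) / (κ - 1)) +
          A₃ * ((Real.exp (-2 * t) - Real.exp (-κ * t)) / (κ - 2)) := by
        funext s; simp [klBoundAux, h1, h2]
      rw [hfun]
      refine ((b1.fun_add b2).fun_add b3).congr_deriv ?_
      field_simp
      ring

section Flow

variable {F : Set (Eucl d)} {T : ℝ} {V V' : FlatQuotient d Γ → ℝ}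
  {ρ ρ' : ℝ → FlatQuotient d Γ → ℝ}

theorem IsSHKSolution.hasDerivAt (hρ : IsSHKSolution F T V ρ) {t : ℝ} (ht : t ∈ Ioo 0 T)
    (θ : FlatQuotient d Γ) : HasDerivAt (fun s => ρ s θ) (timeDeriv T ρ t θ) t :=
  (hρ.hasDerivWithinAt (Ioo_subset_Icc_self ht) θ).hasDerivAt (Icc_mem_nhds ht.1 ht.2)

theorem IsSHKSolution.continuous_lift (hρ : IsSHKSolution F T V ρ) {t : ℝ} (ht : t ∈ Icc 0 T) :
    Continuous (lift (ρ t)) :=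
  (hρ.isC12.contDiff_space t ht).continuous

theorem IsSHKSolution.continuousOn_log (hρ : IsSHKSolution F T V ρ) :
    ContinuousOn (fun p : ℝ × Eucl d => lift (fun θ => Real.log (ρ p.1 θ)) p.2)
      (Icc 0 T ×ˢ univ) :=
  hρ.isC12.continuous.log fun p hp => (hρ.pos p.1 hp.1 _).ne'

theorem IsSHKSolution.birthDeathRate_eq (hρ : IsSHKSolution F T V ρ) {t : ℝ} (ht : t ∈ Icc 0 T)
    (θ : FlatQuotient d Γ) :
    birthDeathRate F V (ρ t) θ = Real.log (ρ t θ) - Real.log (gibbs F V θ) -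
      ∫ η, ρ t η * (Real.log (ρ t η) - Real.log (gibbs F V η)) ∂(vol F) := by
  rw [birthDeathRate, integral_densityMeasure (measurable_of_continuous_lift
    (hρ.continuous_lift ht)) fun θ => (hρ.pos t ht θ).le]

theorem IsSHKSolution.timeDeriv_eq [IsIsometricSMul Γ (Eucl d)]
    (hV : ContDiff ℝ 2 (lift V)) (hρ : IsSHKSolution F T V ρ) {t : ℝ}
    (ht : t ∈ Icc 0 T) (θ : FlatQuotient d Γ) :
    timeDeriv T ρ t θ = fokkerPlanck V (ρ t) θ - birthDeathRate F V (ρ t) θ * ρ t θ := by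
  obtain ⟨x, rfl⟩ := cover_surjective θ
  have h : fokkerPlanck V (ρ t) (cover d Γ x) = divergence (flux V (ρ t)) x :=
    congrFun (lift_fokkerPlanck (hρ.isC12.contDiff_space t ht) hV) x
  rw [h]
  exact hρ.equation t ht x

variable [IsIsometricSMul Γ (Eucl d)] [ProperlyDiscontinuousSMul Γ (Eucl d)]
  [CompactSpace (FlatQuotient d Γ)]

/-- The flow preserves total mass: the defect `Z - 1` of the mass solves the linear equation
`(Z - 1)' = m (Z - 1)`, with `m` the mean of `log (ρ / π)` under `ρ`. -/
theorem IsSHKSolution.integral_eq_one (hF : IsFundamentalDomain Γ F volume)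
    (hV : ContDiff ℝ 2 (lift V)) (hρ : IsSHKSolution F T V ρ)
    (hinit : ∫ θ, ρ 0 θ ∂(vol F) = 1) {t : ℝ} (ht : t ∈ Icc 0 T) :
    ∫ θ, ρ t θ ∂(vol F) = 1 := by
  have := isFiniteMeasure_vol hF
  have hvol := vol_ne_zero hF
  have hπ : Continuous (lift fun θ => Real.log (gibbs F V θ)) :=
    (continuous_lift_gibbs hV.continuous).log fun x => (gibbs_pos hvol hV.continuous _).ne'
  set m : ℝ → ℝ := fun t =>
    ∫ η, ρ t η * (Real.log (ρ t η) - Real.log (gibbs F V η)) ∂(vol F) with hm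
  have hmc : ContinuousOn m (Icc 0 T) :=
    continuousOn_integral_of_continuousOn_prod (hρ.isC12.continuous.mul
      (hρ.continuousOn_log.sub (hπ.comp continuous_snd).continuousOn))
  obtain ⟨C, hC⟩ := isCompact_Icc.exists_bound_of_continuousOn hmc
  set Z : ℝ → ℝ := fun t => ∫ θ, ρ t θ ∂(vol F) with hZ
  have hZc : ContinuousOn Z (Icc 0 T) :=
    continuousOn_integral_of_continuousOn_prod hρ.isC12.continuous
  have hZder : ∀ t ∈ Ioo 0 T, HasDerivAt Z (m t * (Z t - 1)) t := by
    intro t ht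
    have ht' := Ioo_subset_Icc_self ht
    have hc := hρ.continuous_lift ht'
    have hp2 := hρ.isC12.contDiff_space t ht'
    have hlog : Continuous (lift fun θ => Real.log (ρ t θ)) :=
      hc.log fun x => (hρ.pos t ht' _).ne'
    have i1 : Integrable (fokkerPlanck V (ρ t)) (vol F) :=
      integrable_of_continuous_lift (continuous_lift_fokkerPlanck hp2 hV)
    have i2 : Integrable (fun θ => ρ t θ * (Real.log (ρ t θ) - Real.log (gibbs F V θ)))
      (vol F) := integrable_of_continuous_lift (hc.mul (hlog.sub hπ))
    have i3 : Integrable (ρ t) (vol F) := integrable_of_continuous_lift hc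
    refine (hasDerivAt_integral_of_continuousOn_prod (μ := vol F) hρ.isC12.continuous
      hρ.isC12.continuous_time (fun t ht θ => hρ.hasDerivAt ht θ) ht).congr_deriv ?_
    have e : ∀ θ, timeDeriv T ρ t θ = fokkerPlanck V (ρ t) θ -
        (ρ t θ * (Real.log (ρ t θ) - Real.log (gibbs F V θ)) - m t * ρ t θ) := by
      intro θ
      rw [hρ.timeDeriv_eq hV ht', hρ.birthDeathRate_eq ht']
      ring
    simp only [e]
    rw [integral_sub i1 (i2.sub' (i3.const_mul _)), integral_fokkerPlanck hF hp2 hV,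
      integral_sub i2 (i3.const_mul _), integral_const_mul]
    change 0 - (m t - m t * Z t) = m t * (Z t - 1)
    ring
  have hsq : (Z t - 1) ^ 2 ≤ 0 := by
    refine nonpos_of_deriv_le_neg_mul (κ := -(2 * C)) (y := fun t => (Z t - 1) ^ 2)
      (y' := fun t => 2 * (Z t - 1) * (m t * (Z t - 1)))
      ((hZc.sub continuousOn_const).pow 2) (fun t ht => ?_) (fun t ht => ?_) ?_ ht
    · simpa using ((hZder t ht).sub_const 1).fun_pow 2
    · have h1 : m t ≤ C := (le_abs_self _).trans (hC t (Ioo_subset_Icc_self ht))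
      nlinarith [mul_le_mul_of_nonneg_right h1 (sq_nonneg (Z t - 1))]
    · change (∫ θ, ρ 0 θ ∂(vol F) - 1) ^ 2 ≤ 0
      rw [hinit]; norm_num
  have : Z t - 1 = 0 := pow_eq_zero_iff two_ne_zero |>.1 (le_antisymm hsq (sq_nonneg _))
  linarith

/-- The differential inequality for the Kullback–Leibler divergence between two flows with the
same initial density, integrated. -/
theorem IsSHKSolution.klDiv_le_klBound (hF : IsFundamentalDomain Γ F volume)
    (hV : ContDiff ℝ 2 (lift V)) (hV' : ContDiff ℝ 2 (lift V'))
    (hρ : IsSHKSolution F T V ρ) (hρ' : IsSHKSolution F T V' ρ')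
    (hinit : ρ 0 = ρ' 0) (hone : ∫ θ, ρ 0 θ ∂(vol F) = 1)
    {Δ : ℝ} (hΔ : ∀ x, ‖∇ (lift V) x - ∇ (lift V') x‖ ≤ Δ) {l : ℝ} (hl : 0 < l)
    (hLSI : SatisfiesLSI (densityMeasure F (gibbs F V')) l) {B : ℝ} (hB0 : 0 ≤ B)
    (hB : ∀ θ η, (Real.log (ρ 0 θ) + V θ) - (Real.log (ρ 0 η) + V η) ≤ B)
    (hB' : ∀ θ η, (Real.log (ρ' 0 θ) + V' θ) - (Real.log (ρ' 0 η) + V' η) ≤ B)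
    {S : ℝ} (hS : ∀ θ, |Real.log (gibbs F V θ / gibbs F V' θ)| ≤ S)
    {c : ℝ} (hc : c ∈ Ioo (0 : ℝ) 1) {t : ℝ} (ht : t ∈ Icc 0 T) :
    ∫ θ, ρ t θ * (Real.log (ρ t θ) - Real.log (ρ' t θ)) ∂(vol F) ≤ klBound Δ B S l c t := by
  have := isFiniteMeasure_vol hF
  have hvol := vol_ne_zero hF
  have hgpos := gibbs_pos (F := F) hvol hV.continuous
  have hgpos' := gibbs_pos (F := F) hvol hV'.continuous
  have hπ : Continuous (lift fun θ => Real.log (gibbs F V θ)) :=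
    (continuous_lift_gibbs hV.continuous).log fun x => (hgpos _).ne'
  have hπ' : Continuous (lift fun θ => Real.log (gibbs F V' θ)) :=
    (continuous_lift_gibbs hV'.continuous).log fun x => (hgpos' _).ne'
  set κ := 2 * (1 - c) * Real.exp (-B) * l with hκ
  have hκpos : 0 < κ := by have := sub_pos.2 hc.2; positivity
  set A₁ := Δ ^ 2 / (4 * c) with hA₁
  set A₂ := B * (S / 2 + 2) with hA₂
  set A₃ := B ^ 2 / 16 with hA₃
  set H : ℝ → ℝ := fun t => ∫ θ, ρ t θ * (Real.log (ρ t θ) - Real.log (ρ' t θ)) ∂(vol F) with hH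
  set w' : ℝ → FlatQuotient d Γ → ℝ := fun t θ =>
    timeDeriv T ρ t θ * (Real.log (ρ t θ) - Real.log (ρ' t θ)) + timeDeriv T ρ t θ -
      ρ t θ / ρ' t θ * timeDeriv T ρ' t θ with hw'
  have hwc : ContinuousOn (fun p : ℝ × Eucl d =>
      lift (fun θ => ρ p.1 θ * (Real.log (ρ p.1 θ) - Real.log (ρ' p.1 θ))) p.2)
      (Icc 0 T ×ˢ univ) :=
    hρ.isC12.continuous.mul (hρ.continuousOn_log.sub hρ'.continuousOn_log)
  have hwc' : ContinuousOn (fun p : ℝ × Eucl d => lift (w' p.1) p.2) (Icc 0 T ×ˢ univ) :=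
    ((hρ.isC12.continuous_time.mul (hρ.continuousOn_log.sub hρ'.continuousOn_log)).add
      hρ.isC12.continuous_time).sub ((hρ.isC12.continuous.div hρ'.isC12.continuous
        fun p hp => (hρ'.pos p.1 hp.1 _).ne').mul hρ'.isC12.continuous_time)
  have hHc : ContinuousOn H (Icc 0 T) := continuousOn_integral_of_continuousOn_prod hwc
  have hHder : ∀ t ∈ Ioo 0 T, HasDerivAt H (∫ θ, w' t θ ∂(vol F)) t := by
    intro t ht
    refine hasDerivAt_integral_of_continuousOn_prod (μ := vol F) hwc hwc' (fun t ht θ => ?_) ht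
    have hp := (hρ.pos t (Ioo_subset_Icc_self ht) θ).ne'
    have hq := (hρ'.pos t (Ioo_subset_Icc_self ht) θ).ne'
    refine ((hρ.hasDerivAt ht θ).fun_mul (((hρ.hasDerivAt ht θ).log hp).fun_sub
      ((hρ'.hasDerivAt ht θ).log hq))).congr_deriv ?_
    simp only [hw']
    field_simp
    ring
  have hHle : ∀ t ∈ Ioo 0 T, ∫ θ, w' t θ ∂(vol F) ≤
      A₁ + A₂ * Real.exp (-t) + A₃ * Real.exp (-2 * t) - κ * H t := by
    intro t ht'
    have ht := Ioo_subset_Icc_self ht'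
    have hp2 := hρ.isC12.contDiff_space t ht
    have hq2 := hρ'.isC12.contDiff_space t ht
    have hp := hp2.continuous
    have hq := hq2.continuous
    have hppos := hρ.pos t ht
    have hqpos := hρ'.pos t ht
    have hp1 := hρ.integral_eq_one hF hV hone ht
    have hq1 := hρ'.integral_eq_one hF hV' (hinit ▸ hone) ht
    have hlp : Continuous (lift fun θ => Real.log (ρ t θ)) := hp.log fun x => (hppos _).ne'
    have hlq : Continuous (lift fun θ => Real.log (ρ' t θ)) := hq.log fun x => (hqpos _).ne'
    set r := B * Real.exp (-t) with hr
    have hrB : r ≤ B := mul_le_of_le_one_right hB0 (Real.exp_le_one_iff.2 (by linarith [ht.1]))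
    have hosc := fun θ η => hρ.log_add_sub_le hvol hV hB ht θ η
    have hosc' := fun θ η => hρ'.log_add_sub_le hvol hV' hB' ht θ η
    set u : FlatQuotient d Γ → ℝ := fun θ => Real.log (ρ t θ) - Real.log (gibbs F V θ) with hu
    set u' : FlatQuotient d Γ → ℝ := fun θ => Real.log (ρ' t θ) - Real.log (gibbs F V' θ)
      with hu'
    set v : FlatQuotient d Γ → ℝ := fun θ => Real.log (gibbs F V θ) - Real.log (gibbs F V' θ)
      with hv
    have huc : Continuous (lift u) := hlp.sub hπ
    have huc' : Continuous (lift u') := hlq.sub hπ'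
    have hvc : Continuous (lift v) := hπ.sub hπ'
    have hur : ∀ θ η, u θ - u η ≤ r := fun θ η => by
      simp only [hu, log_gibbs hvol hV.continuous]
      linarith [hosc θ η]
    have hur' : ∀ θ η, u' θ - u' η ≤ r := fun θ η => by
      simp only [hu', log_gibbs hvol hV'.continuous]
      linarith [hosc' θ η]
    have hvS : ∀ θ, |v θ| ≤ S := fun θ => by
      have := hS θ
      rwa [Real.log_div (hgpos θ).ne' (hgpos' θ).ne'] at this
    have hbd := integral_birthDeath_le (μ := vol F) hp hq huc huc' hvc hppos hqpos hp1 hq1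
      hur hur' hvS
    have htr := integral_transport_le hF hp2 hq2 hV hV' hppos hqpos hp1 hΔ hc.1
    have hfi := hLSI.klDiv_le_fisher hvol hV'.continuous hl (hp2.of_le (by norm_num))
      (hq2.of_le (by norm_num)) hppos hqpos hp1 hq1 (B := B)
      fun θ η => (hosc' θ η).trans hrB
    set a := ∫ η, ρ t η * u η ∂(vol F) with ha
    set b := ∫ η, ρ' t η * u' η ∂(vol F) with hb
    have hw'eq : ∀ θ, w' t θ = ((Real.log (ρ t θ) - Real.log (ρ' t θ)) * fokkerPlanck V (ρ t) θ
        - ρ t θ / ρ' t θ * fokkerPlanck V' (ρ' t) θ) + fokkerPlanck V (ρ t) θ +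
        ρ t θ * (-(u θ - a) * (u θ - u' θ + v θ) - (u θ - a) + (u' θ - b)) := by
      intro θ
      have hα : birthDeathRate F V (ρ t) θ = u θ - a := hρ.birthDeathRate_eq ht θ
      have hα' : birthDeathRate F V' (ρ' t) θ = u' θ - b := hρ'.birthDeathRate_eq ht θ
      have hh : Real.log (ρ t θ) - Real.log (ρ' t θ) = u θ - u' θ + v θ := by
        simp only [hu, hu', hv]; ring
      have hq0 := (hqpos θ).ne'
      simp only [hw']
      rw [hρ.timeDeriv_eq hV ht, hρ'.timeDeriv_eq hV' ht, hα, hα', hh]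
      field_simp
      ring
    have cF := continuous_lift_fokkerPlanck hp2 hV
    have cF' := continuous_lift_fokkerPlanck hq2 hV'
    have i1 : Integrable (fun θ => (Real.log (ρ t θ) - Real.log (ρ' t θ)) *
        fokkerPlanck V (ρ t) θ - ρ t θ / ρ' t θ * fokkerPlanck V' (ρ' t) θ) (vol F) :=
      integrable_of_continuous_lift (((hlp.sub hlq).mul cF).sub
        ((hp.div hq fun x => (hqpos _).ne').mul cF'))
    have i2 : Integrable (fokkerPlanck V (ρ t)) (vol F) := integrable_of_continuous_lift cF
    have i3 : Integrable (fun θ =>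
        ρ t θ * (-(u θ - a) * (u θ - u' θ + v θ) - (u θ - a) + (u' θ - b))) (vol F) :=
      integrable_of_continuous_lift (hp.mul ((((huc.sub continuous_const).neg.mul
        ((huc.sub huc').add hvc)).sub (huc.sub continuous_const)).add
          (huc'.sub continuous_const)))
    simp only [hw'eq]
    rw [integral_add (i1.fun_add i2) i3, integral_add i1 i2, integral_fokkerPlanck hF hp2 hV]
    have hexp2 : Real.exp (-2 * t) = Real.exp (-t) ^ 2 := by
      rw [← Real.exp_nat_mul]; congr 1; push_cast; ring
    have hfi' := mul_le_mul_of_nonneg_left hfi (sub_pos.2 hc.2).le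
    have e1 : r * (S / 2 + 2) + r ^ 2 / 16 =
        A₂ * Real.exp (-t) + A₃ * Real.exp (-2 * t) := by
      rw [hexp2, hr, hA₂, hA₃]; ring
    have e2 : κ * H t = (1 - c) * (2 * Real.exp (-B) * l *
        ∫ θ, ρ t θ * (Real.log (ρ t θ) - Real.log (ρ' t θ)) ∂(vol F)) := by
      rw [hκ]; ring
    linarith
  have hbound : ∀ t, klBound Δ B S l c t = klBoundAux A₁ A₂ A₃ κ t := fun t => rfl
  have hK := hasDerivAt_klBoundAux A₁ A₂ A₃ hκpos.ne'
  have hmain : H t - klBoundAux A₁ A₂ A₃ κ t ≤ 0 := by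
    refine nonpos_of_deriv_le_neg_mul (κ := κ) (y := fun t => H t - klBoundAux A₁ A₂ A₃ κ t)
      (hHc.sub fun t _ => (hK t).continuousAt.continuousWithinAt)
      (fun t ht => (hHder t ht).fun_sub (hK t)) (fun t ht => ?_) ?_ ht
    · linarith [hHle t ht]
    · have hH0 : H 0 = 0 := by simp [hH, hinit]
      simp [hH0, klBoundAux_zero]
  rw [hbound]
  linarith

end Flow

end

/-! ### Differential privacy -/

theorem theorem4 {d : ℕ} {Γ : Type*} [Group Γ] [MulAction Γ (Eucl d)]
    [IsIsometricSMul Γ (Eucl d)] [ProperlyDiscontinuousSMul Γ (Eucl d)]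
    (hfree : ∀ (γ : Γ) (x : Eucl d), γ • x = x → γ = 1)
    [CompactSpace (FlatQuotient d Γ)]
    (F : Set (Eucl d)) (hF : IsFundamentalDomain Γ F volume)
    {𝒟 : Type*} (adj : 𝒟 → 𝒟 → Prop) (hadj : ∀ D D', adj D D' → adj D' D)
    (V : 𝒟 → FlatQuotient d Γ → ℝ) (hV : ∀ D, ContDiff ℝ 2 (lift (V D)))
    (T : ℝ) (hT : 0 < T)
    (ρ₀ : FlatQuotient d Γ → ℝ) (hρ₀ : ∫ θ, ρ₀ θ ∂(vol F) = 1)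
    (ρ : 𝒟 → ℝ → FlatQuotient d Γ → ℝ) (hinit : ∀ D, ρ D 0 = ρ₀)
    (hρ : ∀ D, IsSHKSolution F T (V D) (ρ D))
    (Δgrad : ℝ)
    (hgrad : ∀ D D', adj D D' → ∀ x : Eucl d, ‖∇ (lift (V D)) x - ∇ (lift (V D')) x‖ ≤ Δgrad)
    (l : ℝ) (hl : 0 < l)
    (hLSI : ∀ D, SatisfiesLSI (densityMeasure F (gibbs F (V D))) l)
    (B : ℝ) (hB : 0 ≤ B)
    (hosc : ∀ D, osc (fun θ => Real.log (ρ₀ θ / gibbs F (V D) θ)) ≤ B) :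
    (∀ S : ℝ,
      (∀ D D', adj D D' → ∀ θ, |Real.log (gibbs F (V D) θ / gibbs F (V D') θ)| ≤ S) →
      ∀ t ∈ Icc 0 T, ∀ c ∈ Ioo (0 : ℝ) 1, ∀ ε : ℝ, 0 < ε →
        IsApproxDP adj (fun D => densityMeasure F (ρ D t)) ε (klBound Δgrad B S l c t / ε)) ∧
    (∀ Δpot : ℝ, (∀ D D', adj D D' → (⨆ θ, |V D θ - V D' θ|) ≤ Δpot) →
      ∀ D D', adj D D' → ∀ θ,
        |Real.log (gibbs F (V D) θ / gibbs F (V D') θ)| ≤ 2 * Δpot) ∧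
    (∀ Δosc : ℝ, (∀ D D', adj D D' → osc (fun θ => V D θ - V D' θ) ≤ Δosc) →
      ∀ D D', adj D D' → ∀ θ,
        |Real.log (gibbs F (V D) θ / gibbs F (V D') θ)| ≤ Δosc) := by
  have := isFiniteMeasure_vol hF
  have hvol := vol_ne_zero hF
  have hpos : ∀ D, ∀ θ, 0 < ρ₀ θ := fun D θ => by
    rw [← hinit D]; exact (hρ D).pos 0 ⟨le_rfl, hT.le⟩ θ
  have hcont : ∀ D, Continuous (lift ρ₀) := fun D => by
    rw [← hinit D]; exact (hρ D).continuous_lift ⟨le_rfl, hT.le⟩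
  have hB' : ∀ D θ η, (Real.log (ρ D 0 θ) + V D θ) - (Real.log (ρ D 0 η) + V D η) ≤ B := by
    intro D θ η
    have hg := gibbs_pos (F := F) hvol (hV D).continuous
    have hc : Continuous (lift fun θ => Real.log (ρ₀ θ / gibbs F (V D) θ)) :=
      ((hcont D).div (continuous_lift_gibbs (hV D).continuous) fun x => (hg _).ne').log
        fun x => (div_pos (hpos D _) (hg _)).ne'
    have h := (sub_le_osc hc θ η).trans (hosc D)
    simp only [Real.log_div (hpos D _).ne' (hg _).ne', log_gibbs hvol (hV D).continuous] at h
    rw [hinit D]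
    linarith
  have hone : ∀ D, ∫ θ, ρ D 0 θ ∂(vol F) = 1 := fun D => by rw [hinit D, hρ₀]
  have hsub : ∀ D D', Continuous (lift fun θ => V D θ - V D' θ) := fun D D' =>
    (hV D).continuous.sub (hV D').continuous
  refine ⟨fun S hS t ht c hc ε hε => ⟨fun D => ?_, fun D D' hDD' A hA => ?_⟩,
    fun Δpot hΔ D D' hDD' θ => ?_, fun Δosc hΔ D D' hDD' θ => ?_⟩
  · exact isProbabilityMeasure_densityMeasure
      (integrable_of_continuous_lift ((hρ D).continuous_lift ht))
      (fun θ => ((hρ D).pos t ht θ).le) ((hρ D).integral_eq_one hF (hV D) (hone D) ht)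
  · exact densityMeasure_real_le_of_klDiv_le ((hρ D).continuous_lift ht)
      ((hρ D').continuous_lift ht) ((hρ D).pos t ht) ((hρ D').pos t ht)
      ((hρ D).integral_eq_one hF (hV D) (hone D) ht)
      ((hρ D').integral_eq_one hF (hV D') (hone D') ht)
      ((hρ D).klDiv_le_klBound hF (hV D) (hV D') (hρ D') ((hinit D).trans (hinit D').symm)
        (hone D) (hgrad D D' hDD') hl (hLSI D') hB (hB' D) (hB' D') (hS D D' hDD') hc ht) hε hA
  · have habs : ∀ η, |V D η - V D' η| ≤ Δpot := fun η =>
      (le_ciSup (bddAbove_of_continuous_lift (f := fun θ => |V D θ - V D' θ|)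
        (hsub D D').abs) η).trans (hΔ D D' hDD')
    refine abs_log_gibbs_div_gibbs_le hvol (hV D).continuous (hV D').continuous
      (fun θ η => ?_) θ
    linarith [(abs_le.1 (habs θ)).2, (abs_le.1 (habs η)).1]
  · exact abs_log_gibbs_div_gibbs_le hvol (hV D).continuous (hV D').continuous
      (fun θ η => (sub_le_osc (hsub D D') θ η).trans (hΔ D D' hDD')) θ
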